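/- **Setting.** $m\ge1$ agents control copies of one system $x_{i,t+1}=Ax_{i,t}+Bu_{i,t}+w_t$, $x_{i,1}=0$, with $x\in\mathbb R^{d_1}$, $u\in\mathbb R^{d_2}$, $d_2\ge 1$, $d=\max\{d_1,d_2\}$; $\|\cdot\|$ is the Euclidean/spectral norm. Constants $\kappa,W,G_c>1$ and $\gamma\in(0,1]$ are given, and it is assumed that: (1) $\|A\|,\|B\|\le\kappa$ and $\|w_t\|\le W$ for all $t$ ($w$ is otherwise arbitrary); (2) each cost $c_{i,t}(x,u)$ is convex and differentiable, and $\|\nabla c_{i,t}(x,u)\|\le G_cD'$ whenever $\|x\|,\|u\|\le D'$; (3) $K$ is $(\kappa,\gamma)$-strongly stable for $(A,B)$: $\|K\|\le\kappa$ and $A-BK=QLQ^{-1}$ with $\|L\|\le1-\gamma$, $\|Q\|,\|Q^{-1}\|\le\kappa$; (4) $(A-BK,B)$ is $(q,\kappa)$-strongly controllable, $q\ge1$: for $C_q=[B,(A-BK)B,\dots,(A-BK)^{q-1}B]$ the matrix $C_qC_q^\top$ is invertible and $\|(C_qC_q^\top)^{-1}\|\le\kappa$. $P\in\mathbb R^{m\times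 m}$ is symmetric, doubly stochastic, with positive diagonal and connected graph; $\beta$ is its second largest singular value ($0$ if $m=1$). **Surrogate costs.** Let $H\ge1$ and $M=(M^{[0]},\dots,M^{[H-1]})$ with $M^{[k]}\in\mathbb R^{d_2\times d_1}$. For a system $(A',B')$, a sequence $w'$ and policies $(M_s)_s$ put $$\Psi_{t,i}=(A'-B'K)^i\mathbf 1_{i\le H}+\sum_{j=0}^{H}(A'-B'K)^jB'M_{t-j}^{[i-j-1]}\mathbf 1_{i-j\in[1,H]},$$ $$y_t=\sum_{i=0}^{2H}\Psi_{t-1,i}w'_{t-1-i},\qquad v_t=-Ky_t+\sum_{k=1}^HM_t^{[k-1]}w'_{t-k},$$ and $f_{i,t}(M_{t-H-1:t}\mid A',B',\{w'\})=c_{i,t}(y_t,v_t)$; write $f_{i,t}(M\mid\cdot)$ if all $M_s=M$. **Algorithm.** Let $\mathcal M=\{M:\|M^{[k]}\|\le2\kappa^3(1-\gamma)^k,\ 0\le k<H\}$, $T_{collect}>q+1$, $T_0=T_{collect}+T_{exchange}$, $\eta>0$. *Exploration*, $1\le t\le T_0$: $u_{i,t}=-Kx_{i,t}+\xi_{i,t}$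 with $\xi_{i,t}\in\{\pm1\}^{d_2}$ random. With $N_{i,k}=\frac1{T_{collect}-(q+1)}\sum_{t=1}^{T_{collect}-(q+1)}x_{i,t+k+1}\xi_{i,t}^\top$, $0\le k\le q$, the agents perform $T_{exchange}$ rounds of $N_{i,k}\leftarrow\sum_jP_{ji}N_{j,k}$ and set $\widehat B_i=N_{i,0}$, $\widehat A_i=C_{i,1}C_{i,0}^\top(C_{i,0}C_{i,0}^\top)^{-1}+\widehat B_iK$, where $C_{i,0}=[N_{i,0},\dots,N_{i,q-1}]$ and $C_{i,1}=[N_{i,1},\dots,N_{i,q}]$. *Learning*, $T_0<t\le T$: all agents start from the same $M_{i,T_0+1}\in\mathcal M$; $\hat w_{i,s}=0$ for $s\le T_0$; $$u_{i,t}=-Kx_{i,t}+\sum_{k=1}^HM_{i,t}^{[k-1]}\hat w_{i,t-k},\qquad \hat w_{i,t}=x_{i,t+1}-\widehat A_ix_{i,t}-\widehat B_iu_{i,t},$$ $$M_{i,t+1}=\Pi_{\mathcal M}\Big[\sum_jP_{ji}M_{j,t}-\eta\nabla f_{i,t}(M_{i,t}\mid\widehat A_i,\widehat B_i,\{\hat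 w_i\})\Big]\quad\text{(Frobenius projection and gradient).}$$ **Theorem.** There is a universal constant $C_1>0$, and for all $m,d_1,d_2,\kappa,\gamma$ as above a constant $C_2>0$ depending only on these five, such that the following holds for every run of the algorithm and every realization of $\xi$. Let $0<\epsilon\le\frac{\gamma^2}{12\kappa^7}$ and $\epsilon'$ be such that, for all agents $i,l$, $\|A-\widehat A_i\|,\|B-\widehat B_i\|\le\epsilon$ and $\|\widehat A_i-\widehat A_l\|,\|\widehat B_i-\widehat B_l\|\le\epsilon'$, and let $\kappa^2(1-\gamma+2\kappa^3\epsilon)^{H+1}<1$. Put $\zeta=\frac{24W\sqrt{d_2}\kappa^7}{\gamma^2}$, $W'=W+\zeta\epsilon$, $\gamma'=\gamma-2\kappa^3\epsilon$, $S=\frac{\kappa^3(\kappa+\epsilon)W'}{\gamma'}+W'$ and $$D=\frac{W'(\kappa^2+2H(\kappa+\epsilon)\kappa^5)}{\gamma'(1-\kappa^2(1-\gamma')^{H+1})}+\frac{2W'\kappa^3}{\gamma}.$$ Then for every agent $j$ and every $M^*\in\mathcal M$ $$\sum_{t=T_0+1}^T\sum_{i=1}^m\Big[f_{i,t}(M_{j,t-H-1:t}\mid\widehat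 A_j,\widehat B_j,\{\hat w_j\})-f_{i,t}(M^*\mid\widehat A_i,\widehat B_i,\{\hat w_i\})\Big]\le C_1\kappa^2\,(E_1+E_2+E_3+E_4+E_5)+\frac{C_2}{\eta},$$ where $$E_1=\eta TmH^3(G_cD)^2(\kappa+\epsilon)\kappa^3W'\frac{S\sqrt m}{1-\beta},\qquad E_3=\eta Tm\sqrt m\,G_cDd^3H\frac{S^2}{1-\beta},$$ $$E_2=mTG_cD\sqrt2\Big[\kappa\Big(\frac{2\kappa^5\epsilon'W'}{\gamma'^2}+\frac{4\kappa^8H^2(\kappa+\epsilon)\epsilon'W'}{(1-\gamma')\gamma'}+\frac{(H+1)2\kappa^5\epsilon'W'}{(1-\gamma')\gamma'}+\frac{\kappa^2+H(\kappa+\epsilon)2\kappa^5}{\gamma'}\,2\zeta\epsilon\Big)+\frac{4\kappa^3\zeta\epsilon}{\gamma}\Big],$$ $$E_4=\eta Tm\big(G_cDd\sqrt d\sqrt H\,S\big)^2,\qquad E_5=\frac1\eta Tm\Big(\frac{\eta G_cDd\sqrt d\sqrt H\,S\sqrt m}{1-\beta}\Big)^2.$$ -/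

import Mathlib

open scoped Matrix.Norms.L2Operator

noncomputable section

namespace DistributedControl

/-! Throughout, `‖·‖` of a matrix is the spectral norm (the `L2Operator` norm), vectors live in
`EuclideanSpace`, and time is integer valued, so that "time `≤ 0`" makes sense. -/

/-- The space `ℝᵈ` with the Euclidean norm. -/
abbrev Vec (d : ℕ) := EuclideanSpace ℝ (Fin d)

/-- State-action pairs `(x, u)` with the Euclidean norm of the concatenated vector. -/
abbrev StateAction (d₁ d₂ : ℕ) := WithLp 2 (Vec d₁ × Vec d₂)

/-- Policy parameters `M = (M^[0], …, M^[H-1])` with `M^[k] ∈ ℝ^{d₂ × d₁}`; the norm of this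
Euclidean space is the Frobenius norm of the tuple. -/
abbrev Param (H d₁ d₂ : ℕ) := EuclideanSpace ℝ (Fin H × Fin d₂ × Fin d₁)

/-- The matrix `M^[k]`. -/
def block {H d₁ d₂ : ℕ} (M : Param H d₁ d₂) (k : Fin H) : Matrix (Fin d₂) (Fin d₁) ℝ :=
  Matrix.of fun a b => M (k, a, b)

/-- The matrix-vector product on Euclidean spaces. -/
def act {n d : ℕ} (A : Matrix (Fin n) (Fin d) ℝ) (x : Vec d) : Vec n :=
  WithLp.toLp 2 (A.mulVec x.ofLp)

/-! ### Strong stability, strong controllability, network, costs -/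

/-- `K` is `(κ, γ)`-strongly stable for the system `(A, B)`. -/
def StronglyStable {d₁ d₂ : ℕ} (κ γ : ℝ) (A : Matrix (Fin d₁) (Fin d₁) ℝ)
    (B : Matrix (Fin d₁) (Fin d₂) ℝ) (K : Matrix (Fin d₂) (Fin d₁) ℝ) : Prop :=
  0 < κ ∧ 0 < γ ∧ γ ≤ 1 ∧ ‖K‖ ≤ κ ∧
    ∃ L Q : Matrix (Fin d₁) (Fin d₁) ℝ, IsUnit Q.det ∧ A - B * K = Q * L * Q⁻¹ ∧
      ‖L‖ ≤ 1 - γ ∧ ‖Q‖ ≤ κ ∧ ‖Q⁻¹‖ ≤ κ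

/-- The block matrix `C_q = [B, AB, …, A^{q-1}B]`. -/
def controllabilityMatrix {d₁ d₂ : ℕ} (q : ℕ) (A : Matrix (Fin d₁) (Fin d₁) ℝ)
    (B : Matrix (Fin d₁) (Fin d₂) ℝ) : Matrix (Fin d₁) (Fin q × Fin d₂) ℝ :=
  Matrix.of fun a kb => (A ^ (kb.1 : ℕ) * B) a kb.2

/-- `(A, B)` is `(q, κ)`-strongly controllable: `C_q` has full row rank, i.e. `C_q C_qᵀ` is
invertible, and the inverse has norm at most `κ`. -/
def StronglyControllable {d₁ d₂ : ℕ} (q : ℕ) (κ : ℝ) (A : Matrix (Fin d₁) (Fin d₁) ℝ)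
    (B : Matrix (Fin d₁) (Fin d₂) ℝ) : Prop :=
  1 ≤ q ∧
    IsUnit (controllabilityMatrix q A B * (controllabilityMatrix q A B).transpose).det ∧
    ‖(controllabilityMatrix q A B * (controllabilityMatrix q A B).transpose)⁻¹‖ ≤ κ

/-- `P` is a symmetric doubly stochastic matrix with positive diagonal, and the undirected graph
of its positive entries is connected. -/
def IsNetworkMatrix {m : ℕ} (P : Matrix (Fin m) (Fin m) ℝ) : Prop :=
  P.IsSymm ∧ P ∈ doublyStochastic ℝ (Fin m) ∧ (∀ i, 0 < P i i) ∧
    (SimpleGraph.fromRel fun i j => 0 < P i j).Connected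

/-- The second largest singular value of `P` (singular values are listed in decreasing order
from index `0`; the value is `0` for a `1 × 1` matrix). -/
def secondSingularValue {m : ℕ} (P : Matrix (Fin m) (Fin m) ℝ) : ℝ :=
  (Matrix.toEuclideanLin P).singularValues 1

/-- The cost is convex and differentiable, and its gradient at `(x, u)` has norm at most `Gc * D`
as soon as `‖x‖, ‖u‖ ≤ D`. -/
def CostAssumption {d₁ d₂ : ℕ} (Gc : ℝ) (c : StateAction d₁ d₂ → ℝ) : Prop :=
  ConvexOn ℝ Set.univ c ∧ Differentiable ℝ c ∧
    ∀ (D : ℝ) (z : StateAction d₁ d₂), ‖z.fst‖ ≤ D → ‖z.snd‖ ≤ D → ‖gradient c z‖ ≤ Gc * D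

/-! ### Disturbance feedback policies and surrogate costs -/

/-- The disturbance-state transfer matrix `Ψ^{K,h}_{t,i}(M_{t-h:t} | A, B)`. The indicator of
`i - j ∈ [1, H]` together with the index `i - j - 1` of the block is expressed by summing over
the blocks `k ∈ {0, …, H-1}` with `i = j + k + 1`. -/
def transferMatrix {H d₁ d₂ : ℕ} (A : Matrix (Fin d₁) (Fin d₁) ℝ)
    (B : Matrix (Fin d₁) (Fin d₂) ℝ) (K : Matrix (Fin d₂) (Fin d₁) ℝ) (h : ℕ)
    (M : ℤ → Param H d₁ d₂) (t : ℤ) (i : ℕ) : Matrix (Fin d₁) (Fin d₁) ℝ :=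
  (if i ≤ h then (A - B * K) ^ i else 0) +
    ∑ j ∈ Finset.range (h + 1), ∑ k : Fin H,
      if i = j + (k : ℕ) + 1 then (A - B * K) ^ j * B * block (M (t - (j : ℤ))) k else 0

/-- The surrogate state at time `t`:
`y_t = ∑_{i=0}^{2H} Ψ^{K,H}_{t-1,i}(M_{t-1-H:t-1} | A, B) w_{t-1-i}`. -/
def surrogateState {H d₁ d₂ : ℕ} (A : Matrix (Fin d₁) (Fin d₁) ℝ)
    (B : Matrix (Fin d₁) (Fin d₂) ℝ) (K : Matrix (Fin d₂) (Fin d₁) ℝ)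
    (w : ℤ → Vec d₁) (M : ℤ → Param H d₁ d₂) (t : ℤ) : Vec d₁ :=
  ∑ i ∈ Finset.range (2 * H + 1),
    act (transferMatrix A B K H M (t - 1) i) (w (t - 1 - (i : ℤ)))

/-- The surrogate action at time `t`: `v_t = -K y_t + ∑_{k=1}^{H} M_t^[k-1] w_{t-k}`. -/
def surrogateAction {H d₁ d₂ : ℕ} (A : Matrix (Fin d₁) (Fin d₁) ℝ)
    (B : Matrix (Fin d₁) (Fin d₂) ℝ) (K : Matrix (Fin d₂) (Fin d₁) ℝ)
    (w : ℤ → Vec d₁) (M : ℤ → Param H d₁ d₂) (t : ℤ) : Vec d₂ :=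
  -act K (surrogateState A B K w M t) +
    ∑ k : Fin H, act (block (M t) k) (w (t - 1 - ((k : ℕ) : ℤ)))

/-- The surrogate cost at time `t`, `c(y_t, v_t)`; it depends on the policy sequence `M` only
through `M_{t-H-1}, …, M_t`. For a time-invariant policy take `M` constant. -/
def surrogateCost {H d₁ d₂ : ℕ} (c : StateAction d₁ d₂ → ℝ) (A : Matrix (Fin d₁) (Fin d₁) ℝ)
    (B : Matrix (Fin d₁) (Fin d₂) ℝ) (K : Matrix (Fin d₂) (Fin d₁) ℝ)
    (w : ℤ → Vec d₁) (t : ℤ) (M : ℤ → Param H d₁ d₂) : ℝ :=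
  c (WithLp.toLp 2 (surrogateState A B K w M t, surrogateAction A B K w M t))

/-- The feasible set `{M : ‖M^[k]‖ ≤ 2κ³(1-γ)^k, k = 0, …, H-1}`. -/
def policySet (H d₁ d₂ : ℕ) (κ γ : ℝ) : Set (Param H d₁ d₂) :=
  {M | ∀ k : Fin H, ‖block M k‖ ≤ 2 * κ ^ 3 * (1 - γ) ^ (k : ℕ)}

/-- `y` is the Euclidean projection of `x` on the set `S`. -/
def IsProjection {E : Type*} [NormedAddCommGroup E] (S : Set E) (x y : E) : Prop :=
  y ∈ S ∧ ∀ z ∈ S, ‖x - y‖ ≤ ‖x - z‖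

/-! ### Distributed system identification -/

/-- The moment `N_{i,k}` of an agent with states `x` and excitations `ξ`, after `Tc` collection
steps: `(Tc - (q+1))⁻¹ ∑_{t=1}^{Tc-(q+1)} x_{t+k+1} ξ_tᵀ`. -/
def moment {d₁ d₂ : ℕ} (q Tc : ℕ) (x : ℤ → Vec d₁) (ξ : ℤ → Vec d₂) (k : ℕ) :
    Matrix (Fin d₁) (Fin d₂) ℝ :=
  ((Tc : ℝ) - ((q : ℝ) + 1))⁻¹ •
    ∑ t ∈ Finset.Icc (1 : ℤ) ((Tc : ℤ) - ((q : ℤ) + 1)),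
      Matrix.vecMulVec (x (t + (k : ℤ) + 1)).ofLp (ξ t).ofLp

/-- Agent `i`'s matrix after `s` rounds of averaging `N_i ← ∑_j P_{ji} N_j`. -/
def exchange {m d₁ d₂ : ℕ} (P : Matrix (Fin m) (Fin m) ℝ)
    (N : Fin m → Matrix (Fin d₁) (Fin d₂) ℝ) : ℕ → Fin m → Matrix (Fin d₁) (Fin d₂) ℝ
  | 0, i => N i
  | s + 1, i => ∑ j, P j i • exchange P N s j

/-- The matrix `N^{T₀}_{i,k}`: `Te` rounds of averaging applied to the collected moments. -/
def finalMoment {m d₁ d₂ : ℕ} (P : Matrix (Fin m) (Fin m) ℝ) (q Tc Te : ℕ)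
    (x : Fin m → ℤ → Vec d₁) (ξ : Fin m → ℤ → Vec d₂) (i : Fin m) (k : ℕ) :
    Matrix (Fin d₁) (Fin d₂) ℝ :=
  exchange P (fun j => moment q Tc (x j) (ξ j) k) Te i

/-- The block matrix `[N^{T₀}_{i,s}, …, N^{T₀}_{i,s+q-1}]`. -/
def momentBlocks {m d₁ d₂ : ℕ} (P : Matrix (Fin m) (Fin m) ℝ) (q Tc Te : ℕ)
    (x : Fin m → ℤ → Vec d₁) (ξ : Fin m → ℤ → Vec d₂) (i : Fin m) (s : ℕ) :
    Matrix (Fin d₁) (Fin q × Fin d₂) ℝ :=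
  Matrix.of fun a kb => finalMoment P q Tc Te x ξ i (s + (kb.1 : ℕ)) a kb.2

/-- Agent `i`'s estimate of `B`. -/
def estB {m d₁ d₂ : ℕ} (P : Matrix (Fin m) (Fin m) ℝ) (q Tc Te : ℕ)
    (x : Fin m → ℤ → Vec d₁) (ξ : Fin m → ℤ → Vec d₂) (i : Fin m) :
    Matrix (Fin d₁) (Fin d₂) ℝ :=
  finalMoment P q Tc Te x ξ i 0

/-- Agent `i`'s estimate of `A`: `C₁ C₀ᵀ (C₀ C₀ᵀ)⁻¹ + B̂ᵢ K`. -/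
def estA {m d₁ d₂ : ℕ} (P : Matrix (Fin m) (Fin m) ℝ) (K : Matrix (Fin d₂) (Fin d₁) ℝ)
    (q Tc Te : ℕ) (x : Fin m → ℤ → Vec d₁) (ξ : Fin m → ℤ → Vec d₂) (i : Fin m) :
    Matrix (Fin d₁) (Fin d₁) ℝ :=
  momentBlocks P q Tc Te x ξ i 1 * (momentBlocks P q Tc Te x ξ i 0).transpose *
      (momentBlocks P q Tc Te x ξ i 0 * (momentBlocks P q Tc Te x ξ i 0).transpose)⁻¹ +
    estB P q Tc Te x ξ i * K

/-! ### The two-phase distributed algorithm -/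

/-- All the sequences produced by the `m` agents: states, actions, random excitations, estimated
disturbances, and policy parameters. -/
structure Trajectory (m H d₁ d₂ : ℕ) where
  x : Fin m → ℤ → Vec d₁
  u : Fin m → ℤ → Vec d₂
  ξ : Fin m → ℤ → Vec d₂
  what : Fin m → ℤ → Vec d₁
  M : Fin m → ℤ → Param H d₁ d₂

namespace Trajectory

variable {m H d₁ d₂ : ℕ}

/-- Agent `i`'s estimate of `A` computed from the exploration phase of the trajectory. -/
def hatA (τ : Trajectory m H d₁ d₂) (P : Matrix (Fin m) (Fin m) ℝ)
    (K : Matrix (Fin d₂) (Fin d₁) ℝ) (q Tc Te : ℕ) (i : Fin m) : Matrix (Fin d₁) (Fin d₁) ℝ :=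
  estA P K q Tc Te τ.x τ.ξ i

/-- Agent `i`'s estimate of `B` computed from the exploration phase of the trajectory. -/
def hatB (τ : Trajectory m H d₁ d₂) (P : Matrix (Fin m) (Fin m) ℝ)
    (q Tc Te : ℕ) (i : Fin m) : Matrix (Fin d₁) (Fin d₂) ℝ :=
  estB P q Tc Te τ.x τ.ξ i

/-- Agent `l`'s estimated surrogate of the cost `c`: the function `f_t(· | Âₗ, B̂ₗ, {ŵₗ})` of the
policy sequence. -/
def estimatedCost (τ : Trajectory m H d₁ d₂) (P : Matrix (Fin m) (Fin m) ℝ)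
    (K : Matrix (Fin d₂) (Fin d₁) ℝ) (q Tc Te : ℕ) (c : StateAction d₁ d₂ → ℝ) (l : Fin m)
    (t : ℤ) (M : ℤ → Param H d₁ d₂) : ℝ :=
  surrogateCost c (τ.hatA P K q Tc Te l) (τ.hatB P q Tc Te l) K (τ.what l) t M

/-- The unprojected distributed gradient step of agent `i` at time `t`. -/
def gradientStep (τ : Trajectory m H d₁ d₂) (P : Matrix (Fin m) (Fin m) ℝ)
    (K : Matrix (Fin d₂) (Fin d₁) ℝ) (q Tc Te : ℕ) (η : ℝ)
    (c : Fin m → ℤ → StateAction d₁ d₂ → ℝ) (i : Fin m) (t : ℤ) : Param H d₁ d₂ :=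
  ∑ j, P j i • τ.M j t -
    η • gradient (fun M : Param H d₁ d₂ =>
      τ.estimatedCost P K q Tc Te (c i t) i t fun _ => M) (τ.M i t)

/-- `τ` is a run, up to the horizon `T`, of the two-phase distributed disturbance feedback
controller on the system `(A, B)` with disturbances `w`, for some realization `τ.ξ` of the
`±1`-valued excitations. The exploration phase has length `T₀ = Tc + Te`. The values `τ.M i t`
for `t ≤ T₀` are irrelevant, since they only ever multiply `τ.what i s` with `s ≤ T₀`. -/
structure IsRun (τ : Trajectory m H d₁ d₂) (A : Matrix (Fin d₁) (Fin d₁) ℝ)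
    (B : Matrix (Fin d₁) (Fin d₂) ℝ) (K : Matrix (Fin d₂) (Fin d₁) ℝ) (w : ℤ → Vec d₁)
    (P : Matrix (Fin m) (Fin m) ℝ) (c : Fin m → ℤ → StateAction d₁ d₂ → ℝ)
    (κ γ η : ℝ) (q Tc Te T : ℕ) : Prop where
  /-- The system starts at the origin. -/
  init_state : ∀ i, τ.x i 1 = 0
  /-- The dynamics of every agent. -/
  dynamics : ∀ i (t : ℤ), 1 ≤ t → τ.x i (t + 1) = act A (τ.x i t) + act B (τ.u i t) + w t
  /-- The excitations have entries `±1`. -/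
  excitation : ∀ i (t : ℤ) a, τ.ξ i t a = 1 ∨ τ.ξ i t a = -1
  /-- The control in the exploration phase. -/
  explore : ∀ i (t : ℤ), 1 ≤ t → t ≤ (Tc : ℤ) + Te → τ.u i t = -act K (τ.x i t) + τ.ξ i t
  /-- The control in the learning phase. -/
  control : ∀ i (t : ℤ), (Tc : ℤ) + Te < t → t ≤ T →
    τ.u i t = -act K (τ.x i t) +
      ∑ k : Fin H, act (block (τ.M i t) k) (τ.what i (t - 1 - ((k : ℕ) : ℤ)))
  /-- No disturbance estimate is available before the learning phase. -/
  what_explore : ∀ i (t : ℤ), t ≤ (Tc : ℤ) + Te → τ.what i t = 0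
  /-- The disturbance estimates in the learning phase. -/
  what_learn : ∀ i (t : ℤ), (Tc : ℤ) + Te < t → t ≤ T →
    τ.what i t = τ.x i (t + 1) - act (τ.hatA P K q Tc Te i) (τ.x i t) -
      act (τ.hatB P q Tc Te i) (τ.u i t)
  /-- All agents start the learning phase from the same feasible policy. -/
  init_policy : ∃ M₀ ∈ policySet H d₁ d₂ κ γ, ∀ i, τ.M i ((Tc : ℤ) + Te + 1) = M₀
  /-- The projected distributed gradient step. -/
  update : ∀ i (t : ℤ), (Tc : ℤ) + Te < t → t ≤ T →
    IsProjection (policySet H d₁ d₂ κ γ) (τ.gradientStep P K q Tc Te η c i t) (τ.M i (t + 1))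

/-- The memory-regret of agent `j` against the fixed policy `Mstar`, measured on the estimated
costs:
`∑_{t=T₀+1}^{T} ∑_i [f_{i,t}(M_{j,t-H-1:t} | Âⱼ, B̂ⱼ, {ŵⱼ}) - f_{i,t}(M* | Âᵢ, B̂ᵢ, {ŵᵢ})]`. -/
def memoryRegret (τ : Trajectory m H d₁ d₂) (P : Matrix (Fin m) (Fin m) ℝ)
    (K : Matrix (Fin d₂) (Fin d₁) ℝ) (q Tc Te T : ℕ)
    (c : Fin m → ℤ → StateAction d₁ d₂ → ℝ) (j : Fin m) (Mstar : Param H d₁ d₂) : ℝ :=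
  ∑ t ∈ Finset.Icc ((Tc : ℤ) + Te + 1) (T : ℤ), ∑ i,
    (τ.estimatedCost P K q Tc Te (c i t) j t (τ.M j) -
      τ.estimatedCost P K q Tc Te (c i t) i t fun _ => Mstar)

end Trajectory

/-! ### The quantities in the bound -/

/-- `ζ = 24 W √d₂ κ⁷ / γ²`. -/
def zeta (κ γ W : ℝ) (d₂ : ℕ) : ℝ := 24 * W * √(d₂ : ℝ) * κ ^ 7 / γ ^ 2

/-- `W + ζ ε`. -/
def noiseBound (κ γ W ε : ℝ) (d₂ : ℕ) : ℝ := W + zeta κ γ W d₂ * ε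

/-- The radius `D`. -/
def radius (κ γ W ε : ℝ) (d₂ H : ℕ) : ℝ :=
  noiseBound κ γ W ε d₂ * (κ ^ 2 + 2 * H * (κ + ε) * κ ^ 5) /
      ((γ - 2 * κ ^ 3 * ε) * (1 - κ ^ 2 * (1 - γ + 2 * κ ^ 3 * ε) ^ (H + 1))) +
    2 * noiseBound κ γ W ε d₂ * κ ^ 3 / γ

/-- The factor `κ³(κ+ε)(W+ζε)/(γ-2κ³ε) + (W+ζε)`. -/
def sensitivity (κ γ W ε : ℝ) (d₂ : ℕ) : ℝ :=
  κ ^ 3 * (κ + ε) * noiseBound κ γ W ε d₂ / (γ - 2 * κ ^ 3 * ε) + noiseBound κ γ W ε d₂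

/-- The term for the memory of the costs (`D` is the radius, `S` the sensitivity factor). -/
def memoryTerm (m H T : ℕ) (η Gc D κ ε W' S β : ℝ) : ℝ :=
  η * T * m * H ^ 3 * (Gc * D) ^ 2 * (κ + ε) * κ ^ 3 * W' * (S * √(m : ℝ) / (1 - β))

/-- The term for the errors `ε`, `ε'` of the estimates (`W'` is `W + ζ ε`). -/
def estimationTerm (m H T : ℕ) (Gc D κ γ ε ε' W' ζ : ℝ) : ℝ :=
  m * T * Gc * D * √2 *
    (κ * (2 * κ ^ 5 * ε' * W' / (γ - 2 * κ ^ 3 * ε) ^ 2 +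
        4 * κ ^ 8 * H ^ 2 * (κ + ε) * ε' * W' /
          ((1 - γ + 2 * κ ^ 3 * ε) * (γ - 2 * κ ^ 3 * ε)) +
        (H + 1) * 2 * κ ^ 5 * ε' * W' / ((1 - γ + 2 * κ ^ 3 * ε) * (γ - 2 * κ ^ 3 * ε)) +
        (κ ^ 2 + H * (κ + ε) * 2 * κ ^ 5) / (γ - 2 * κ ^ 3 * ε) * (2 * ζ * ε)) +
      4 * κ ^ 3 * ζ * ε / γ)

/-- The term for the disagreement of the agents. -/
def disagreementTerm (m H T : ℕ) (η Gc D d S β : ℝ) : ℝ :=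
  η * T * m * √(m : ℝ) * Gc * D * d ^ 3 * H * (S ^ 2 / (1 - β))

/-- The term for the squared gradients. -/
def gradientTerm (m H T : ℕ) (η Gc D d S : ℝ) : ℝ :=
  η * T * m * (Gc * D * d * √d * √(H : ℝ) * S) ^ 2

/-- The term for the averaging error of the network. -/
def consensusTerm (m H T : ℕ) (η Gc D d S β : ℝ) : ℝ :=
  1 / η * T * m * (η * Gc * D * d * √d * √(H : ℝ) * S * √(m : ℝ) / (1 - β)) ^ 2

end DistributedControl

end

/-!
The learning phase is projected gradient descent with a consensus step. Gradients of the surrogate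
costs are bounded by some `G`, so every step moves a policy by at most `η G`. Averaging with `P`
contracts the disagreement of the agents by the factor `β`, hence all policies, and also the
policies of consecutive rounds, stay within a constant multiple of `R = η G √m / (1 - β)` of each
other. Convexity and the usual telescoping of `∑ i, ‖M i t - M*‖²` then bound the regret of every
agent against its own surrogate costs.

The theorem compares with agent `j`'s surrogate costs instead. Surrogate states and actions are
determined by geometrically damped sums of past disturbances, so replacing agent `j`'s past policies
by its current policy, its system and disturbances by those of agent `i`, and its policy by that of
agent `i`, changes them by at most `surrogateGap`; the costs are Lipschitz on the ball of radius
`surrogateRadius`.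

The disturbance estimates are controlled by a bootstrap: if they are bounded by `W + ζ ε` before
time `t`, then states and controls up to time `t` are bounded, and the error
`(A - Â) x + (B - B̂) u` of the estimate at time `t` is at most `ζ ε`.
-/

namespace DistributedControl

section Act

variable {n d e : ℕ}

lemma act_eq_toEuclideanLin (A : Matrix (Fin n) (Fin d) ℝ) (x : Vec d) :
    act A x = Matrix.toEuclideanLin A x := rfl

lemma add_act (A B : Matrix (Fin n) (Fin d) ℝ) (x : Vec d) :
    act (A + B) x = act A x + act B x := by
  simp [act_eq_toEuclideanLin]

lemma sub_act (A B : Matrix (Fin n) (Fin d) ℝ) (x : Vec d) :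
    act (A - B) x = act A x - act B x := by
  simp [act_eq_toEuclideanLin]

lemma zero_act (x : Vec d) : act (0 : Matrix (Fin n) (Fin d) ℝ) x = 0 := by
  simp [act_eq_toEuclideanLin]

lemma one_act (x : Vec d) : act (1 : Matrix (Fin d) (Fin d) ℝ) x = x := by
  simp [act]

lemma smul_act (r : ℝ) (A : Matrix (Fin n) (Fin d) ℝ) (x : Vec d) :
    act (r • A) x = r • act A x := by
  simp [act_eq_toEuclideanLin]

lemma sum_act {ι : Type*} (s : Finset ι) (A : ι → Matrix (Fin n) (Fin d) ℝ) (x : Vec d) :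
    act (∑ i ∈ s, A i) x = ∑ i ∈ s, act (A i) x := by
  simp [act_eq_toEuclideanLin]

lemma act_zero (A : Matrix (Fin n) (Fin d) ℝ) : act A 0 = 0 := by
  simp [act_eq_toEuclideanLin]

lemma act_add (A : Matrix (Fin n) (Fin d) ℝ) (x y : Vec d) :
    act A (x + y) = act A x + act A y := by
  simp [act_eq_toEuclideanLin]

lemma act_sub (A : Matrix (Fin n) (Fin d) ℝ) (x y : Vec d) :
    act A (x - y) = act A x - act A y := by
  simp [act_eq_toEuclideanLin]

lemma act_sum {ι : Type*} (s : Finset ι) (A : Matrix (Fin n) (Fin d) ℝ) (x : ι → Vec d) :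
    act A (∑ i ∈ s, x i) = ∑ i ∈ s, act A (x i) := by
  simp [act_eq_toEuclideanLin]

lemma act_act (A : Matrix (Fin n) (Fin d) ℝ) (B : Matrix (Fin d) (Fin e) ℝ) (x : Vec e) :
    act A (act B x) = act (A * B) x := by
  simp [act, Matrix.mulVec_mulVec]

lemma norm_act_le (A : Matrix (Fin n) (Fin d) ℝ) (x : Vec d) : ‖act A x‖ ≤ ‖A‖ * ‖x‖ :=
  Matrix.l2_opNorm_mulVec A x

lemma norm_act_le_of_le {A : Matrix (Fin n) (Fin d) ℝ} {x : Vec d} {a b : ℝ} (hA : ‖A‖ ≤ a)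
    (hx : ‖x‖ ≤ b) : ‖act A x‖ ≤ a * b :=
  (norm_act_le A x).trans
    (mul_le_mul hA hx (norm_nonneg x) ((norm_nonneg A).trans hA))

lemma norm_le_of_forall_norm_act_le {A : Matrix (Fin n) (Fin d) ℝ} {a : ℝ} (ha : 0 ≤ a)
    (h : ∀ x, ‖act A x‖ ≤ a * ‖x‖) : ‖A‖ ≤ a := by
  rw [Matrix.l2_opNorm_def]
  exact ContinuousLinearMap.opNorm_le_bound _ ha h

lemma norm_one_le : ‖(1 : Matrix (Fin d) (Fin d) ℝ)‖ ≤ 1 :=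
  norm_le_of_forall_norm_act_le zero_le_one fun x => by rw [one_act, one_mul]

lemma norm_matrixMul_le_of_le {A : Matrix (Fin n) (Fin d) ℝ} {B : Matrix (Fin d) (Fin e) ℝ}
    {a b : ℝ} (hA : ‖A‖ ≤ a) (hB : ‖B‖ ≤ b) : ‖A * B‖ ≤ a * b :=
  (Matrix.l2_opNorm_mul A B).trans
    (mul_le_mul hA hB (norm_nonneg B) ((norm_nonneg A).trans hA))

lemma norm_pow_le_of_le {A : Matrix (Fin d) (Fin d) ℝ} {a : ℝ} (hA : ‖A‖ ≤ a) (k : ℕ) :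
    ‖A ^ k‖ ≤ a ^ k := by
  induction k with
  | zero => simpa using norm_one_le
  | succ k ih => simpa only [pow_succ] using norm_matrixMul_le_of_le ih hA

lemma norm_sq_le_sum_sq (A : Matrix (Fin n) (Fin d) ℝ) : ‖A‖ ^ 2 ≤ ∑ a, ∑ b, A a b ^ 2 := by
  have frobenius_nonneg : 0 ≤ ∑ a, ∑ b, A a b ^ 2 := by positivity
  rw [← Real.le_sqrt (norm_nonneg A) frobenius_nonneg]
  refine norm_le_of_forall_norm_act_le (Real.sqrt_nonneg _) fun x => ?_
  refine le_of_sq_le_sq ?_ (by positivity)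
  rw [mul_pow, Real.sq_sqrt frobenius_nonneg, EuclideanSpace.norm_sq_eq,
    EuclideanSpace.norm_sq_eq, Finset.sum_mul]
  refine Finset.sum_le_sum fun a _ => ?_
  simp only [act, Matrix.mulVec, dotProduct, Real.norm_eq_abs, sq_abs]
  exact Finset.sum_mul_sq_le_sq_mul_sq _ _ _

lemma sum_sq_le_card_mul_norm_sq (A : Matrix (Fin n) (Fin d) ℝ) :
    ∑ a, ∑ b, A a b ^ 2 ≤ d * ‖A‖ ^ 2 := by
  have column_le (b : Fin d) : ∑ a, A a b ^ 2 ≤ ‖A‖ ^ 2 := by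
    have h : ‖act A (EuclideanSpace.single b 1)‖ ≤ ‖A‖ := by
      simpa using norm_act_le A (EuclideanSpace.single b 1)
    calc ∑ a, A a b ^ 2 = ‖act A (EuclideanSpace.single b 1)‖ ^ 2 := by
          simp [EuclideanSpace.norm_sq_eq, act]
      _ ≤ ‖A‖ ^ 2 := by gcongr
  rw [Finset.sum_comm]
  simpa using Finset.sum_le_sum fun b (_ : b ∈ Finset.univ) => column_le b

end Act

section GeometricSums

variable {ρ : ℝ}

lemma sum_range_pow_le (h0 : 0 ≤ ρ) (h1 : ρ < 1) (n : ℕ) :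
    ∑ k ∈ Finset.range n, ρ ^ k ≤ 1 / (1 - ρ) := by
  rw [one_div, ← tsum_geometric_of_lt_one h0 h1]
  exact (summable_geometric_of_lt_one h0 h1).sum_le_tsum _ fun _ _ => by positivity

lemma sum_fin_pow_le (h0 : 0 ≤ ρ) (h1 : ρ < 1) (n : ℕ) :
    ∑ k : Fin n, ρ ^ (k : ℕ) ≤ 1 / (1 - ρ) := by
  rw [Fin.sum_univ_eq_sum_range (fun k => ρ ^ k)]
  exact sum_range_pow_le h0 h1 n

lemma sum_range_mul_pow_pred_le (h0 : 0 ≤ ρ) (h1 : ρ < 1) (n : ℕ) :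
    ∑ k ∈ Finset.range n, (k : ℝ) * ρ ^ (k - 1) ≤ 1 / (1 - ρ) ^ 2 := by
  have derivative_series : HasSum (fun k : ℕ => ((k : ℝ) + 1) * ρ ^ k) (1 / (1 - ρ) ^ 2) := by
    simpa using hasSum_choose_mul_geometric_of_norm_lt_one 1
      (by rwa [Real.norm_of_nonneg h0] : ‖ρ‖ < 1)
  cases n with
  | zero => simpa using sq_nonneg (1 - ρ)
  | succ n =>
    rw [Finset.sum_range_succ']
    simpa using sum_le_hasSum (Finset.range n) (fun k _ => by positivity) derivative_series

lemma sum_range_mul_pow_pred_le_mul (h0 : 0 ≤ ρ) (h1 : ρ < 1) (n : ℕ) :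
    ∑ k ∈ Finset.range (n + 1), (k : ℝ) * ρ ^ (k - 1) ≤ n / (1 - ρ) := by
  rw [Finset.sum_range_succ']
  calc ∑ k ∈ Finset.range n, ((k + 1 : ℕ) : ℝ) * ρ ^ (k + 1 - 1) + ((0 : ℕ) : ℝ) * ρ ^ (0 - 1)
      ≤ ∑ k ∈ Finset.range n, (n : ℝ) * ρ ^ k := by
        simp only [Nat.cast_zero, zero_mul, add_zero, Nat.add_sub_cancel]
        gcongr with k hk
        exact Finset.mem_range.1 hk
    _ = n * ∑ k ∈ Finset.range n, ρ ^ k := by rw [Finset.mul_sum]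
    _ ≤ n * (1 / (1 - ρ)) := by gcongr; exact sum_range_pow_le h0 h1 n
    _ = n / (1 - ρ) := mul_one_div _ _

end GeometricSums

section Policy

variable {H d₁ d₂ : ℕ} {κ γ : ℝ}

lemma block_add (M N : Param H d₁ d₂) (k : Fin H) : block (M + N) k = block M k + block N k := rfl

lemma block_sub (M N : Param H d₁ d₂) (k : Fin H) : block (M - N) k = block M k - block N k := rfl

lemma block_smul (r : ℝ) (M : Param H d₁ d₂) (k : Fin H) : block (r • M) k = r • block M k := rfl

lemma norm_sq_eq_sum_block (M : Param H d₁ d₂) :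
    ‖M‖ ^ 2 = ∑ k : Fin H, ∑ a, ∑ b, block M k a b ^ 2 := by
  simp [EuclideanSpace.norm_sq_eq, Fintype.sum_prod_type, block]

lemma sum_norm_block_le (M : Param H d₁ d₂) : ∑ k : Fin H, ‖block M k‖ ≤ √(H : ℝ) * ‖M‖ := by
  refine le_of_sq_le_sq ?_ (by positivity)
  rw [mul_pow, Real.sq_sqrt (by positivity), norm_sq_eq_sum_block]
  calc (∑ k : Fin H, ‖block M k‖) ^ 2 ≤ H * ∑ k : Fin H, ‖block M k‖ ^ 2 := by
        simpa using sq_sum_le_card_mul_sum_sq (s := Finset.univ) (f := fun k : Fin H => ‖block M k‖)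
    _ ≤ H * ∑ k : Fin H, ∑ a, ∑ b, block M k a b ^ 2 := by gcongr; exact norm_sq_le_sum_sq _

lemma sum_norm_block_le_of_mem_policySet (hγ : 0 < γ) (hγ1 : γ ≤ 1) (hκ : 0 ≤ κ)
    {M : Param H d₁ d₂} (hM : M ∈ policySet H d₁ d₂ κ γ) :
    ∑ k : Fin H, ‖block M k‖ ≤ 2 * κ ^ 3 / γ := by
  calc ∑ k : Fin H, ‖block M k‖ ≤ ∑ k : Fin H, 2 * κ ^ 3 * (1 - γ) ^ (k : ℕ) :=
        Finset.sum_le_sum fun k _ => hM k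
    _ = 2 * κ ^ 3 * ∑ k : Fin H, (1 - γ) ^ (k : ℕ) := by rw [Finset.mul_sum]
    _ ≤ 2 * κ ^ 3 * (1 / (1 - (1 - γ))) := by
        gcongr; exact sum_fin_pow_le (by linarith) (by linarith) H
    _ = 2 * κ ^ 3 / γ := by rw [sub_sub_cancel, mul_one_div]

lemma convex_policySet : Convex ℝ (policySet H d₁ d₂ κ γ) := by
  have block_ball (k : Fin H) :
      Convex ℝ {M : Param H d₁ d₂ | ‖block M k‖ ≤ 2 * κ ^ 3 * (1 - γ) ^ (k : ℕ)} := by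
    let blockₗ : Param H d₁ d₂ →ₗ[ℝ] Matrix (Fin d₂) (Fin d₁) ℝ :=
      { toFun := fun M => block M k
        map_add' := fun M N => block_add M N k
        map_smul' := fun r M => block_smul r M k }
    simpa [Set.preimage, blockₗ] using
      (convex_closedBall (0 : Matrix (Fin d₂) (Fin d₁) ℝ) _).linear_preimage blockₗ
  simpa [policySet, Set.ofPred_forall] using convex_iInter block_ball

lemma norm_sub_sq_le_of_mem_policySet (hγ : 0 < γ) (hγ1 : γ ≤ 1)
    {M N : Param H d₁ d₂} (hM : M ∈ policySet H d₁ d₂ κ γ) (hN : N ∈ policySet H d₁ d₂ κ γ) :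
    ‖M - N‖ ^ 2 ≤ 16 * d₁ * κ ^ 6 / γ := by
  have contraction_nonneg : 0 ≤ 1 - γ := by linarith
  have block_sq_le (k : Fin H) : ‖block (M - N) k‖ ^ 2 ≤ 16 * κ ^ 6 * (1 - γ) ^ (k : ℕ) := by
    have block_le : ‖block (M - N) k‖ ≤ 4 * κ ^ 3 * (1 - γ) ^ (k : ℕ) := by
      rw [block_sub]
      linarith [norm_sub_le (block M k) (block N k), hM k, hN k]
    calc ‖block (M - N) k‖ ^ 2 ≤ (4 * κ ^ 3 * (1 - γ) ^ (k : ℕ)) ^ 2 := by gcongr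
      _ = 16 * κ ^ 6 * ((1 - γ) ^ (k : ℕ) * (1 - γ) ^ (k : ℕ)) := by ring
      _ ≤ 16 * κ ^ 6 * (1 - γ) ^ (k : ℕ) := by
          gcongr; exact mul_le_of_le_one_right (by positivity)
            (pow_le_one₀ contraction_nonneg (by linarith))
  calc ‖M - N‖ ^ 2 ≤ ∑ k : Fin H, (d₁ : ℝ) * ‖block (M - N) k‖ ^ 2 := by
        rw [norm_sq_eq_sum_block]
        exact Finset.sum_le_sum fun k _ => sum_sq_le_card_mul_norm_sq _
    _ ≤ ∑ k : Fin H, (d₁ : ℝ) * (16 * κ ^ 6 * (1 - γ) ^ (k : ℕ)) := by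
        gcongr with k; exact block_sq_le k
    _ = d₁ * (16 * κ ^ 6) * ∑ k : Fin H, (1 - γ) ^ (k : ℕ) := by
        rw [Finset.mul_sum]; exact Finset.sum_congr rfl fun _ _ => by ring
    _ ≤ d₁ * (16 * κ ^ 6) * (1 / (1 - (1 - γ))) := by
        gcongr; exact sum_fin_pow_le contraction_nonneg (by linarith) H
    _ = 16 * d₁ * κ ^ 6 / γ := by rw [sub_sub_cancel]; ring

end Policy

lemma IsProjection.norm_sub_le {E : Type*} [NormedAddCommGroup E] [InnerProductSpace ℝ E]
    {S : Set E} (hS : Convex ℝ S) {x y z : E} (h : IsProjection S x y) (hz : z ∈ S) :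
    ‖y - z‖ ≤ ‖x - z‖ := by
  have dist_eq_iInf : ‖x - y‖ = ⨅ w : S, ‖x - w‖ := by
    have : Nonempty S := ⟨⟨y, h.1⟩⟩
    refine le_antisymm (le_ciInf fun w => h.2 w w.2) ?_
    exact ciInf_le ⟨0, by rintro _ ⟨w, rfl⟩; exact norm_nonneg _⟩ (⟨y, h.1⟩ : S)
  have obtuse := (norm_eq_iInf_iff_real_inner_le_zero hS h.1).1 dist_eq_iInf z hz
  have expand : ‖x - z‖ ^ 2 = ‖x - y‖ ^ 2 - 2 * inner ℝ (x - y) (z - y) + ‖y - z‖ ^ 2 := by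
    rw [← sub_sub_sub_cancel_right x z y, norm_sub_sq_real, norm_sub_rev z y]
  refine le_of_sq_le_sq ?_ (norm_nonneg _)
  linarith [sq_nonneg ‖x - y‖]

section SingularValues

variable {E F : Type*} [NormedAddCommGroup E] [InnerProductSpace ℝ E] [FiniteDimensional ℝ E]
  [NormedAddCommGroup F] [InnerProductSpace ℝ F] [FiniteDimensional ℝ F] {n : ℕ}

/-- The right singular vectors of `T`, listed in decreasing order of the singular values. -/
noncomputable def rightSingularBasis (T : E →ₗ[ℝ] F) (hn : Module.finrank ℝ E = n) :
    OrthonormalBasis (Fin n) ℝ E :=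
  T.isSymmetric_adjoint_comp_self.eigenvectorBasis hn

variable (T : E →ₗ[ℝ] F) (hn : Module.finrank ℝ E = n)

lemma adjoint_apply_rightSingularBasis (k : Fin n) :
    T.adjoint (T (rightSingularBasis T hn k)) =
      T.singularValues k ^ 2 • rightSingularBasis T hn k := by
  rw [T.sq_singularValues_fin hn]
  exact T.isSymmetric_adjoint_comp_self.apply_eigenvectorBasis hn k

lemma norm_sq_apply_eq_sum_singularValues (x : E) :
    ‖T x‖ ^ 2 =
      ∑ k : Fin n, T.singularValues k ^ 2 * inner ℝ (rightSingularBasis T hn k) x ^ 2 := by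
  rw [← real_inner_self_eq_norm_sq, ← T.adjoint_inner_right,
    ← (rightSingularBasis T hn).sum_inner_mul_inner]
  refine Finset.sum_congr rfl fun k _ => ?_
  rw [T.adjoint_inner_right, ← T.adjoint_inner_left, adjoint_apply_rightSingularBasis,
    real_inner_smul_left, real_inner_comm]
  ring

lemma norm_apply_rightSingularBasis (k : Fin n) :
    ‖T (rightSingularBasis T hn k)‖ = T.singularValues k := by
  refine (pow_left_inj₀ (norm_nonneg _) (T.singularValues_nonneg k) two_ne_zero).1 ?_
  rw [← real_inner_self_eq_norm_sq, ← T.adjoint_inner_right, adjoint_apply_rightSingularBasis,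
    real_inner_smul_right, real_inner_self_eq_norm_sq, (rightSingularBasis T hn).norm_eq_one]
  ring

lemma norm_apply_le_singularValues_mul_norm {j : ℕ} {x : E}
    (hx : ∀ k : Fin n, (k : ℕ) < j → inner ℝ (rightSingularBasis T hn k) x = 0) :
    ‖T x‖ ≤ T.singularValues j * ‖x‖ := by
  refine le_of_sq_le_sq ?_ (mul_nonneg (T.singularValues_nonneg j) (norm_nonneg x))
  rw [mul_pow, ← (rightSingularBasis T hn).sum_sq_inner_right x, Finset.mul_sum,
    norm_sq_apply_eq_sum_singularValues T hn]
  refine Finset.sum_le_sum fun k _ => ?_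
  rcases lt_or_ge (k : ℕ) j with hk | hk
  · simp [hx k hk]
  · gcongr
    · exact T.singularValues_nonneg k
    · exact T.singularValues_antitone hk

end SingularValues

section Network

variable {m : ℕ} {P : Matrix (Fin m) (Fin m) ℝ}

lemma norm_sq_sub_norm_sq_act (hP : P ∈ doublyStochastic ℝ (Fin m)) (v : Vec m) :
    ‖v‖ ^ 2 - ‖act P v‖ ^ 2 = ∑ i, ∑ j, P i j * (v j - act P v i) ^ 2 := by
  have act_apply (i : Fin m) : act P v i = ∑ j, P i j * v j := rfl
  have variance (i : Fin m) : ∑ j, P i j * (v j - act P v i) ^ 2 =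
      ∑ j, P i j * v j ^ 2 - act P v i ^ 2 := by
    calc ∑ j, P i j * (v j - act P v i) ^ 2
        = ∑ j, (P i j * v j ^ 2 - 2 * act P v i * (P i j * v j) + act P v i ^ 2 * P i j) :=
          Finset.sum_congr rfl fun j _ => by ring
      _ = ∑ j, P i j * v j ^ 2 - 2 * act P v i * act P v i + act P v i ^ 2 * 1 := by
          rw [Finset.sum_add_distrib, Finset.sum_sub_distrib, ← Finset.mul_sum, ← Finset.mul_sum,
            sum_row_of_mem_doublyStochastic hP i, act_apply]
      _ = ∑ j, P i j * v j ^ 2 - act P v i ^ 2 := by ring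
  have weighted_norm : ∑ i, ∑ j, P i j * v j ^ 2 = ‖v‖ ^ 2 := by
    rw [Finset.sum_comm, EuclideanSpace.real_norm_sq_eq]
    refine Finset.sum_congr rfl fun j _ => ?_
    rw [← Finset.sum_mul, sum_col_of_mem_doublyStochastic hP j, one_mul]
  simp only [variance, Finset.sum_sub_distrib, weighted_norm, EuclideanSpace.real_norm_sq_eq]

lemma norm_act_le_of_mem_doublyStochastic (hP : P ∈ doublyStochastic ℝ (Fin m)) (v : Vec m) :
    ‖act P v‖ ≤ ‖v‖ := by
  refine le_of_sq_le_sq ?_ (norm_nonneg v)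
  rw [← sub_nonneg, norm_sq_sub_norm_sq_act hP]
  exact Finset.sum_nonneg fun i _ => Finset.sum_nonneg fun j _ =>
    mul_nonneg (nonneg_of_mem_doublyStochastic hP) (sq_nonneg _)

lemma act_one_of_mem_doublyStochastic (hP : P ∈ doublyStochastic ℝ (Fin m)) :
    act P (WithLp.toLp 2 1) = WithLp.toLp 2 1 := by
  ext i
  simpa [act, Matrix.mulVec, dotProduct] using sum_row_of_mem_doublyStochastic hP i

lemma IsNetworkMatrix.apply_eq_of_norm_act_eq (hP : IsNetworkMatrix P) {v : Vec m}
    (hv : ‖act P v‖ = ‖v‖) (a b : Fin m) : v a = v b := by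
  obtain ⟨-, stochastic, diag_pos, connected⟩ := hP
  have nonneg (i j : Fin m) : 0 ≤ P i j * (v j - act P v i) ^ 2 :=
    mul_nonneg (nonneg_of_mem_doublyStochastic stochastic) (sq_nonneg _)
  have variance_eq_zero : ∑ i, ∑ j, P i j * (v j - act P v i) ^ 2 = 0 := by
    rw [← norm_sq_sub_norm_sq_act stochastic, hv, sub_self]
  have eq_act (i j : Fin m) (hij : 0 < P i j) : v j = act P v i := by
    have row := (Finset.sum_eq_zero_iff_of_nonneg fun i _ =>
      Finset.sum_nonneg fun j _ => nonneg i j).1 variance_eq_zero i (Finset.mem_univ i)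
    have entry := (Finset.sum_eq_zero_iff_of_nonneg fun j _ => nonneg i j).1 row j
      (Finset.mem_univ j)
    simpa [hij.ne', sub_eq_zero] using entry
  have eq_of_pos (i j : Fin m) (hij : 0 < P i j) : v i = v j :=
    (eq_act i i (diag_pos i)).trans (eq_act i j hij).symm
  obtain ⟨walk⟩ := connected.preconnected a b
  induction walk with
  | nil => rfl
  | cons adj _ ih =>
    refine Eq.trans ?_ ih
    rcases (SimpleGraph.fromRel_adj _ _ _).1 adj with ⟨-, h | h⟩
    · exact eq_of_pos _ _ h
    · exact (eq_of_pos _ _ h).symm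

lemma secondSingularValue_nonneg : 0 ≤ secondSingularValue P :=
  LinearMap.singularValues_nonneg _ _

lemma IsNetworkMatrix.rightSingularBasis_apply_eq (hP : IsNetworkMatrix P) {k : Fin m}
    (hk : 1 ≤ (Matrix.toEuclideanLin P).singularValues k) (a b : Fin m) :
    rightSingularBasis (Matrix.toEuclideanLin P) finrank_euclideanSpace_fin k a =
      rightSingularBasis (Matrix.toEuclideanLin P) finrank_euclideanSpace_fin k b := by
  refine hP.apply_eq_of_norm_act_eq ?_ a b
  refine le_antisymm (norm_act_le_of_mem_doublyStochastic hP.2.1 _) ?_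
  rwa [act_eq_toEuclideanLin, norm_apply_rightSingularBasis, OrthonormalBasis.norm_eq_one]

lemma IsNetworkMatrix.one_le_singularValues_zero (hP : IsNetworkMatrix P) :
    1 ≤ (Matrix.toEuclideanLin P).singularValues 0 := by
  have : Nonempty (Fin m) := hP.2.2.2.nonempty
  have ones_pos : 0 < ‖(WithLp.toLp 2 1 : Vec m)‖ :=
    norm_pos_iff.2 fun h => one_ne_zero (congrArg (fun v : Vec m => v (Classical.arbitrary _)) h)
  have norm_ones_le := norm_apply_le_singularValues_mul_norm (Matrix.toEuclideanLin P)
    finrank_euclideanSpace_fin (x := WithLp.toLp 2 1) (j := 0)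
    fun _ h => absurd h (Nat.not_lt_zero _)
  rw [← act_eq_toEuclideanLin, act_one_of_mem_doublyStochastic hP.2.1] at norm_ones_le
  exact le_of_mul_le_mul_right (by rwa [one_mul]) ones_pos

lemma IsNetworkMatrix.norm_act_le (hP : IsNetworkMatrix P) {z : Vec m} (hz : ∑ i, z i = 0) :
    ‖act P z‖ ≤ secondSingularValue P * ‖z‖ := by
  refine norm_apply_le_singularValues_mul_norm (Matrix.toEuclideanLin P)
    finrank_euclideanSpace_fin fun k hk => ?_
  have const := hP.rightSingularBasis_apply_eq (k := k)
    (by rw [Nat.lt_one_iff.1 hk]; exact hP.one_le_singularValues_zero)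
  simp only [PiLp.inner_apply, RCLike.inner_apply, conj_trivial, fun i => const i k,
    ← Finset.sum_mul, hz, zero_mul]

lemma inner_eq_of_apply_eq {v w : Vec m} (a : Fin m) (hv : ∀ i, v i = v a) (hw : ∀ i, w i = w a) :
    inner ℝ v w = m * (v a * w a) := by
  simp [PiLp.inner_apply, hv, hw, mul_comm]

lemma IsNetworkMatrix.secondSingularValue_lt_one (hP : IsNetworkMatrix P) :
    secondSingularValue P < 1 := by
  set T := Matrix.toEuclideanLin P
  rcases le_or_gt m 1 with hm | hm
  · rw [secondSingularValue, LinearMap.singularValues_of_finrank_le _ (by simpa using hm)]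
    exact zero_lt_one
  by_contra! one_le
  set e := rightSingularBasis T finrank_euclideanSpace_fin
  set i₀ : Fin m := ⟨0, by omega⟩
  set i₁ : Fin m := ⟨1, hm⟩
  have const₀ (i : Fin m) : e i₀ i = e i₀ i₀ :=
    hP.rightSingularBasis_apply_eq hP.one_le_singularValues_zero i i₀
  have const₁ (i : Fin m) : e i₁ i = e i₁ i₀ := hP.rightSingularBasis_apply_eq (k := i₁) one_le i i₀
  have normSq₀ : (m : ℝ) * (e i₀ i₀ * e i₀ i₀) = 1 := by
    rw [← inner_eq_of_apply_eq i₀ const₀ const₀, real_inner_self_eq_norm_sq, e.norm_eq_one, one_pow]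
  have normSq₁ : (m : ℝ) * (e i₁ i₀ * e i₁ i₀) = 1 := by
    rw [← inner_eq_of_apply_eq i₀ const₁ const₁, real_inner_self_eq_norm_sq, e.norm_eq_one, one_pow]
  have orthogonal : (m : ℝ) * (e i₀ i₀ * e i₁ i₀) = 0 := by
    rw [← inner_eq_of_apply_eq i₀ const₀ const₁]
    exact e.orthonormal.2 (by simp [i₀, i₁])
  have : (1 : ℝ) = 0 :=
    calc (1 : ℝ) = (m * (e i₀ i₀ * e i₀ i₀)) * (m * (e i₁ i₀ * e i₁ i₀)) := by
          rw [normSq₀, normSq₁, one_mul]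
      _ = (m * (e i₀ i₀ * e i₁ i₀)) ^ 2 := by ring
      _ = 0 := by rw [orthogonal]; norm_num
  exact one_ne_zero this

end Network

section Averaging

variable {m : ℕ}

section Module

variable {E : Type*} [AddCommGroup E] [Module ℝ E] {P : Matrix (Fin m) (Fin m) ℝ}

/-- One round of averaging with the weights `P`. The weights of agent `i` are the column `P · i`,
as in the exchange step of the algorithm. -/
noncomputable def mix (P : Matrix (Fin m) (Fin m) ℝ) (x : Fin m → E) (i : Fin m) : E :=
  ∑ j, P j i • x j

/-- The mean of the vectors held by the agents. -/
noncomputable def average (x : Fin m → E) : E := (m : ℝ)⁻¹ • ∑ i, x i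

lemma sum_sub_average (x : Fin m → E) : ∑ i, (x i - average x) = 0 := by
  rcases m.eq_zero_or_pos with rfl | hm
  · simp
  have : (m : ℝ) ≠ 0 := by exact_mod_cast hm.ne'
  rw [Finset.sum_sub_distrib, Finset.sum_const, Finset.card_univ, Fintype.card_fin, average,
    ← Nat.cast_smul_eq_nsmul ℝ, smul_smul, mul_inv_cancel₀ this, one_smul, sub_self]

lemma mix_sub (hP : P ∈ doublyStochastic ℝ (Fin m)) (x : Fin m → E) (c : E) (i : Fin m) :
    mix P x i - c = mix P (fun j => x j - c) i := by
  simp only [mix, smul_sub, Finset.sum_sub_distrib]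
  rw [← Finset.sum_smul, sum_col_of_mem_doublyStochastic hP i, one_smul]

lemma mix_mem (hP : P ∈ doublyStochastic ℝ (Fin m)) {S : Set E} (hS : Convex ℝ S)
    {x : Fin m → E} (hx : ∀ j, x j ∈ S) (i : Fin m) : mix P x i ∈ S :=
  hS.sum_mem (fun _ _ => nonneg_of_mem_doublyStochastic hP)
    (sum_col_of_mem_doublyStochastic hP i) fun j _ => hx j

end Module

section NormedSpace

variable {E : Type*} [NormedAddCommGroup E] [NormedSpace ℝ E] {P : Matrix (Fin m) (Fin m) ℝ}

/-- The deviations of the agents from their mean. They are collected in an `ℓ²` product, whose norm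
is the root of the sum of the squared deviations. -/
noncomputable def deviation (x : Fin m → E) : PiLp 2 fun _ : Fin m => E :=
  WithLp.toLp 2 fun i => x i - average x

lemma deviation_const (c : E) : deviation (fun _ : Fin m => c) = 0 := by
  refine PiLp.ext fun i => ?_
  have : (m : ℝ) ≠ 0 := by exact_mod_cast i.pos.ne'
  simp [deviation, average, ← Nat.cast_smul_eq_nsmul ℝ, this]

lemma norm_sub_average_le (x : Fin m → E) (i : Fin m) : ‖x i - average x‖ ≤ ‖deviation x‖ :=
  PiLp.norm_apply_le (deviation x) i

lemma norm_mix_sub_le (hP : P ∈ doublyStochastic ℝ (Fin m)) {x : Fin m → E} {c : E} {δ : ℝ}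
    (hx : ∀ j, ‖x j - c‖ ≤ δ) (i : Fin m) : ‖mix P x i - c‖ ≤ δ :=
  mem_closedBall_iff_norm.1 <| mix_mem hP (convex_closedBall c δ)
    (fun j => mem_closedBall_iff_norm.2 (hx j)) i

lemma norm_mix_sq_le (hP : P ∈ doublyStochastic ℝ (Fin m)) (x : Fin m → E) (i : Fin m) :
    ‖mix P x i‖ ^ 2 ≤ ∑ j, P j i * ‖x j‖ ^ 2 :=
  ((convexOn_norm convex_univ).pow (fun _ _ => norm_nonneg _) 2).map_sum_le
    (fun _ _ => nonneg_of_mem_doublyStochastic hP) (sum_col_of_mem_doublyStochastic hP i)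
    fun _ _ => Set.mem_univ _

lemma sum_norm_mix_sub_sq_le (hP : P ∈ doublyStochastic ℝ (Fin m)) (x : Fin m → E) (c : E) :
    ∑ i, ‖mix P x i - c‖ ^ 2 ≤ ∑ i, ‖x i - c‖ ^ 2 := by
  calc ∑ i, ‖mix P x i - c‖ ^ 2 ≤ ∑ i, ∑ j, P j i * ‖x j - c‖ ^ 2 := by
        gcongr with i
        rw [mix_sub hP]
        exact norm_mix_sq_le hP _ i
    _ = ∑ j, ‖x j - c‖ ^ 2 := by
        rw [Finset.sum_comm]
        refine Finset.sum_congr rfl fun j _ => ?_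
        rw [← Finset.sum_mul, sum_row_of_mem_doublyStochastic hP j, one_mul]

end NormedSpace

lemma norm_deviation_le {E : Type*} [NormedAddCommGroup E] [InnerProductSpace ℝ E]
    (x : Fin m → E) (c : E) :
    ‖deviation x‖ ≤ ‖(WithLp.toLp 2 fun i => x i - c : PiLp 2 fun _ : Fin m => E)‖ := by
  refine le_of_sq_le_sq ?_ (norm_nonneg _)
  simp only [deviation, PiLp.norm_sq_eq_of_L2]
  have bias_variance (i : Fin m) : ‖x i - c‖ ^ 2 = ‖x i - average x‖ ^ 2 +
      2 * inner ℝ (x i - average x) (average x - c) + ‖average x - c‖ ^ 2 := by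
    rw [← norm_add_sq_real, sub_add_sub_cancel]
  have bias_nonneg : 0 ≤ ∑ _i : Fin m, ‖average x - c‖ ^ 2 := by positivity
  rw [Finset.sum_congr rfl fun i _ => bias_variance i, Finset.sum_add_distrib,
    Finset.sum_add_distrib, ← Finset.mul_sum, ← sum_inner, sum_sub_average, inner_zero_left]
  linarith

end Averaging

section Consensus

variable {m : ℕ} {P : Matrix (Fin m) (Fin m) ℝ} {ι : Type*} [Fintype ι]

lemma IsNetworkMatrix.norm_mix_le (hP : IsNetworkMatrix P) {v : Fin m → EuclideanSpace ℝ ι}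
    (hv : ∑ i, v i = 0) :
    ‖(WithLp.toLp 2 (mix P v) : PiLp 2 fun _ : Fin m => EuclideanSpace ℝ ι)‖ ≤
      secondSingularValue P * ‖(WithLp.toLp 2 v : PiLp 2 fun _ : Fin m => EuclideanSpace ℝ ι)‖ := by
  refine le_of_sq_le_sq ?_ (mul_nonneg secondSingularValue_nonneg (norm_nonneg _))
  have coordinate_le (c : ι) : ∑ i, (mix P v i) c ^ 2 ≤
      secondSingularValue P ^ 2 * ∑ i, v i c ^ 2 := by
    have h := hP.norm_act_le (z := WithLp.toLp 2 fun i => v i c)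
      (by simpa using congrArg (fun f : EuclideanSpace ℝ ι => f c) hv)
    have h := pow_le_pow_left₀ (norm_nonneg _) h 2
    rw [mul_pow, EuclideanSpace.real_norm_sq_eq, EuclideanSpace.real_norm_sq_eq] at h
    simpa [act, mix, Matrix.mulVec, dotProduct, fun i j => hP.1.apply i j] using h
  rw [mul_pow, PiLp.norm_sq_eq_of_L2, PiLp.norm_sq_eq_of_L2]
  simp only [EuclideanSpace.real_norm_sq_eq]
  rw [Finset.sum_comm, Finset.sum_comm (f := fun i c => v i c ^ 2), Finset.mul_sum]
  exact Finset.sum_le_sum fun c _ => coordinate_le c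

lemma IsNetworkMatrix.norm_deviation_le (hP : IsNetworkMatrix P)
    {x y : Fin m → EuclideanSpace ℝ ι} {r : ℝ} (hr : 0 ≤ r) (h : ∀ i, ‖y i - mix P x i‖ ≤ r) :
    ‖deviation y‖ ≤ secondSingularValue P * ‖deviation x‖ + √(m : ℝ) * r := by
  set mixed : PiLp 2 fun _ : Fin m => EuclideanSpace ℝ ι :=
    WithLp.toLp 2 (mix P fun j => x j - average x)
  set perturbation : PiLp 2 fun _ : Fin m => EuclideanSpace ℝ ι :=
    WithLp.toLp 2 fun i => y i - mix P x i
  have perturbation_le : ‖perturbation‖ ≤ √(m : ℝ) * r := by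
    refine le_of_sq_le_sq ?_ (by positivity)
    rw [PiLp.norm_sq_eq_of_L2, mul_pow, Real.sq_sqrt (Nat.cast_nonneg m)]
    simpa using Finset.sum_le_sum fun i (_ : i ∈ Finset.univ) =>
      pow_le_pow_left₀ (norm_nonneg _) (h i) 2
  have decomposition : (WithLp.toLp 2 fun i => y i - average x :
      PiLp 2 fun _ : Fin m => EuclideanSpace ℝ ι) = mixed + perturbation := by
    refine PiLp.ext fun i => ?_
    change y i - average x = mix P (fun j => x j - average x) i + (y i - mix P x i)
    rw [← mix_sub hP.2.1]; abel
  calc ‖deviation y‖ ≤ ‖mixed + perturbation‖ :=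
        decomposition ▸ DistributedControl.norm_deviation_le y (average x)
    _ ≤ ‖mixed‖ + ‖perturbation‖ := norm_add_le _ _
    _ ≤ secondSingularValue P * ‖deviation x‖ + √(m : ℝ) * r :=
        add_le_add (hP.norm_mix_le (sum_sub_average x)) perturbation_le

/-- The distance from their mean within which agents remain when every averaging round is perturbed
by at most `r`: the fixed point of `R ↦ β R + √m r`, where `β` is the second singular value. -/
noncomputable def consensusRadius (P : Matrix (Fin m) (Fin m) ℝ) (r : ℝ) : ℝ :=
  r * √(m : ℝ) / (1 - secondSingularValue P)

lemma IsNetworkMatrix.consensusRadius_nonneg (hP : IsNetworkMatrix P) {r : ℝ} (hr : 0 ≤ r) :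
    0 ≤ consensusRadius P r :=
  div_nonneg (by positivity) (by linarith [hP.secondSingularValue_lt_one])

lemma IsNetworkMatrix.le_consensusRadius (hP : IsNetworkMatrix P) {r : ℝ} (hr : 0 ≤ r) :
    r ≤ consensusRadius P r := by
  have one_le_card : 1 ≤ √(m : ℝ) :=
    Real.one_le_sqrt.2 (by exact_mod_cast Fin.pos_iff_nonempty.2 hP.2.2.2.nonempty)
  rw [consensusRadius, le_div_iff₀ (by linarith [hP.secondSingularValue_lt_one])]
  gcongr
  linarith [secondSingularValue_nonneg (P := P)]

/-- During the rounds `a, …, b` each agent updates to the average of the network up to an error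
`r`, starting from a common vector. -/
structure IsPerturbedAveraging {E : Type*} [NormedAddCommGroup E] [NormedSpace ℝ E]
    (P : Matrix (Fin m) (Fin m) ℝ) (r : ℝ) (M : Fin m → ℤ → E) (a b : ℤ) : Prop where
  init : ∃ M₀, ∀ i, M i a = M₀
  step : ∀ i t, a ≤ t → t ≤ b → ‖M i (t + 1) - mix P (fun j => M j t) i‖ ≤ r

namespace IsPerturbedAveraging

variable {M : Fin m → ℤ → EuclideanSpace ℝ ι} {a b t : ℤ} {r : ℝ}

lemma norm_deviation_le (h : IsPerturbedAveraging P r M a b) (hP : IsNetworkMatrix P) (hr : 0 ≤ r)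
    (hat : a ≤ t) (htb : t ≤ b + 1) : ‖deviation fun i => M i t‖ ≤ consensusRadius P r := by
  induction t, hat using Int.leInduction with
  | base =>
    obtain ⟨M₀, hM₀⟩ := h.init
    simpa [hM₀, deviation_const] using hP.consensusRadius_nonneg hr
  | succ t hat ih =>
    have gap_pos : 0 < 1 - secondSingularValue P := by linarith [hP.secondSingularValue_lt_one]
    calc ‖deviation fun i => M i (t + 1)‖
        ≤ secondSingularValue P * ‖deviation fun i => M i t‖ + √(m : ℝ) * r :=
          hP.norm_deviation_le hr fun i => h.step i t hat (by lia)
      _ ≤ secondSingularValue P * consensusRadius P r + √(m : ℝ) * r := by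
          gcongr
          · exact secondSingularValue_nonneg
          · exact ih (by lia)
      _ = consensusRadius P r := by rw [consensusRadius]; field_simp; ring

lemma norm_sub_le (h : IsPerturbedAveraging P r M a b) (hP : IsNetworkMatrix P) (hr : 0 ≤ r)
    (hat : a ≤ t) (htb : t ≤ b + 1) (i l : Fin m) : ‖M i t - M l t‖ ≤ 2 * consensusRadius P r := by
  have close (i : Fin m) : ‖M i t - average fun i => M i t‖ ≤ consensusRadius P r :=
    (norm_sub_average_le _ i).trans (h.norm_deviation_le hP hr hat htb)
  rw [← sub_sub_sub_cancel_right _ _ (average fun i => M i t)]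
  linarith [_root_.norm_sub_le (M i t - average fun i => M i t) (M l t - average fun i => M i t),
    close i, close l]

lemma norm_mix_sub_le (h : IsPerturbedAveraging P r M a b) (hP : IsNetworkMatrix P) (hr : 0 ≤ r)
    (hat : a ≤ t) (htb : t ≤ b + 1) (i : Fin m) :
    ‖mix P (fun j => M j t) i - M i t‖ ≤ 2 * consensusRadius P r :=
  DistributedControl.norm_mix_sub_le hP.2.1 (fun j => h.norm_sub_le hP hr hat htb j i) i

lemma norm_succ_sub_le (h : IsPerturbedAveraging P r M a b) (hP : IsNetworkMatrix P) (hr : 0 ≤ r)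
    (hat : a ≤ t) (htb : t ≤ b) (i : Fin m) :
    ‖M i (t + 1) - M i t‖ ≤ 3 * consensusRadius P r := by
  rw [← sub_add_sub_cancel _ (mix P (fun j => M j t) i)]
  linarith [norm_add_le (M i (t + 1) - mix P (fun j => M j t) i) (mix P (fun j => M j t) i - M i t),
    h.step i t hat htb, hP.le_consensusRadius hr, h.norm_mix_sub_le hP hr hat (by lia) i]

lemma norm_sub_prev_le (h : IsPerturbedAveraging P r M a b) (hP : IsNetworkMatrix P) (hr : 0 ≤ r)
    (htb : t ≤ b + 1) (i : Fin m) {n : ℕ} (hn : a ≤ t - n) :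
    ‖M i (t - n) - M i t‖ ≤ n * (3 * consensusRadius P r) := by
  induction n with
  | zero => simp
  | succ n ih =>
    have last := h.norm_succ_sub_le hP hr hn (by push_cast; lia) i
    rw [norm_sub_rev, show t - ((n + 1 : ℕ) : ℤ) + 1 = t - n by push_cast; ring] at last
    rw [← sub_add_sub_cancel _ (M i (t - n))]
    have := ih (by push_cast at hn; lia)
    have := norm_add_le (M i (t - ((n + 1 : ℕ) : ℤ)) - M i (t - n)) (M i (t - n) - M i t)
    push_cast at *
    linarith

end IsPerturbedAveraging

end Consensus

section ProjectedDescent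

variable {m : ℕ} {E : Type*} [NormedAddCommGroup E] [InnerProductSpace ℝ E]

lemma two_mul_inner_le_of_norm_sub_le {η : ℝ} {g x y z : E} (h : ‖y - x‖ ≤ ‖z - η • g - x‖) :
    2 * η * inner ℝ g (z - x) ≤ ‖z - x‖ ^ 2 - ‖y - x‖ ^ 2 + η ^ 2 * ‖g‖ ^ 2 := by
  have expand : ‖z - η • g - x‖ ^ 2 =
      ‖z - x‖ ^ 2 - 2 * η * inner ℝ g (z - x) + η ^ 2 * ‖g‖ ^ 2 := by
    rw [sub_right_comm, norm_sub_sq_real (z - x), real_inner_smul_right, norm_smul, mul_pow,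
      Real.norm_eq_abs, sq_abs, real_inner_comm]
    ring
  linarith [pow_le_pow_left₀ (norm_nonneg _) h 2]

lemma sum_Icc_sub_le {φ : ℤ → ℝ} (hφ : ∀ t, 0 ≤ φ t) (a b : ℤ) :
    ∑ t ∈ Finset.Icc a b, (φ t - φ (t + 1)) ≤ φ a := by
  rcases lt_or_ge b a with h | h
  · simpa [Finset.Icc_eq_empty_of_lt h] using hφ a
  suffices telescope : ∑ t ∈ Finset.Icc a b, (φ t - φ (t + 1)) = φ a - φ (b + 1) by
    linarith [hφ (b + 1)]
  induction b, h using Int.leInduction with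
  | base => simp
  | succ b hab ih =>
    rw [← Finset.insert_Icc_right_eq_Icc_add_one (by lia), Finset.sum_insert (by simp), ih]
    ring

/-- Distributed projected gradient descent on the set `S` during the rounds `a, …, b`, with step
size `η` and with `g i t` as agent `i`'s (sub)gradient in round `t`. -/
structure IsProjectedDescent (P : Matrix (Fin m) (Fin m) ℝ) (S : Set E) (η : ℝ)
    (g M : Fin m → ℤ → E) (a b : ℤ) : Prop where
  init : ∃ M₀ ∈ S, ∀ i, M i a = M₀
  update : ∀ i t, a ≤ t → t ≤ b →
    IsProjection S (mix P (fun j => M j t) i - η • g i t) (M i (t + 1))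

namespace IsProjectedDescent

variable {P : Matrix (Fin m) (Fin m) ℝ} {S : Set E} {η G R : ℝ} {g M : Fin m → ℤ → E} {a b t : ℤ}

lemma mem (h : IsProjectedDescent P S η g M a b) (hat : a ≤ t) (htb : t ≤ b + 1) (i : Fin m) :
    M i t ∈ S := by
  rcases eq_or_lt_of_le hat with rfl | hat
  · obtain ⟨M₀, hM₀, hM⟩ := h.init
    rwa [hM i]
  · simpa using (h.update i (t - 1) (by lia) (by lia)).1

lemma isPerturbedAveraging (h : IsProjectedDescent P S η g M a b)
    (hP : P ∈ doublyStochastic ℝ (Fin m)) (hS : Convex ℝ S) (hη : 0 ≤ η)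
    (hg : ∀ i t, a ≤ t → t ≤ b → ‖g i t‖ ≤ G) : IsPerturbedAveraging P (η * G) M a b where
  init := h.init.imp fun _ hM₀ => hM₀.2
  step i t hat htb := by
    have mixed_mem := mix_mem hP hS (fun j => h.mem hat (by lia) j) i
    calc ‖M i (t + 1) - mix P (fun j => M j t) i‖
        ≤ ‖mix P (fun j => M j t) i - η • g i t - mix P (fun j => M j t) i‖ :=
          (h.update i t hat htb).norm_sub_le hS mixed_mem
      _ = η * ‖g i t‖ := by
          rw [sub_sub_cancel_left, norm_neg, norm_smul, Real.norm_of_nonneg hη]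
      _ ≤ η * G := by gcongr; exact hg i t hat htb

lemma two_mul_inner_le (h : IsProjectedDescent P S η g M a b) (hS : Convex ℝ S) (hη : 0 ≤ η)
    (hg : ∀ i, ‖g i t‖ ≤ G) (hR : ∀ i, ‖mix P (fun j => M j t) i - M i t‖ ≤ R)
    (hat : a ≤ t) (htb : t ≤ b) {x : E} (hx : x ∈ S) (i : Fin m) :
    2 * η * inner ℝ (g i t) (M i t - x) ≤
      ‖mix P (fun j => M j t) i - x‖ ^ 2 - ‖M i (t + 1) - x‖ ^ 2 +
        2 * η * (η * G ^ 2 / 2 + G * R) := by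
  set z := mix P (fun j => M j t) i
  have descent := two_mul_inner_le_of_norm_sub_le ((h.update i t hat htb).norm_sub_le hS hx)
  have averaging : -inner ℝ (g i t) (z - M i t) ≤ G * R := by
    rw [← inner_neg_right]
    calc inner ℝ (g i t) (-(z - M i t)) ≤ ‖g i t‖ * ‖-(z - M i t)‖ := real_inner_le_norm _ _
      _ ≤ G * R := by
          rw [norm_neg]
          exact mul_le_mul (hg i) (hR i) (norm_nonneg _) ((norm_nonneg _).trans (hg i))
  have split : inner ℝ (g i t) (M i t - x) =
      inner ℝ (g i t) (z - x) + -inner ℝ (g i t) (z - M i t) := by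
    rw [← sub_eq_add_neg, ← inner_sub_right, sub_sub_sub_cancel_left]
  have gradient_le : η ^ 2 * ‖g i t‖ ^ 2 ≤ η ^ 2 * G ^ 2 := by gcongr; exact hg i
  have averaging_le : 2 * η * -inner ℝ (g i t) (z - M i t) ≤ 2 * η * (G * R) := by gcongr
  rw [split]
  linarith

theorem sum_inner_le (h : IsProjectedDescent P S η g M a b)
    (hP : P ∈ doublyStochastic ℝ (Fin m)) (hS : Convex ℝ S) (hη : 0 < η)
    (hg : ∀ i t, a ≤ t → t ≤ b → ‖g i t‖ ≤ G)
    (hR : ∀ i t, a ≤ t → t ≤ b → ‖mix P (fun j => M j t) i - M i t‖ ≤ R) {x : E} (hx : x ∈ S) :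
    ∑ t ∈ Finset.Icc a b, ∑ i, inner ℝ (g i t) (M i t - x) ≤
      (∑ i, ‖M i a - x‖ ^ 2) / (2 * η) +
        ((Finset.Icc a b).card : ℝ) * (m * (η * G ^ 2 / 2 + G * R)) := by
  set φ : ℤ → ℝ := fun t => (∑ i, ‖M i t - x‖ ^ 2) / (2 * η) with hφ
  have round_le (t : ℤ) (ht : t ∈ Finset.Icc a b) : ∑ i, inner ℝ (g i t) (M i t - x) ≤
      (φ t - φ (t + 1)) + m * (η * G ^ 2 / 2 + G * R) := by
    obtain ⟨hat, htb⟩ := Finset.mem_Icc.1 ht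
    have agents_le := Finset.sum_le_sum fun i (_ : i ∈ Finset.univ) =>
      h.two_mul_inner_le hS hη.le (fun i => hg i t hat htb) (fun i => hR i t hat htb) hat htb hx i
    rw [← Finset.mul_sum, Finset.sum_add_distrib, Finset.sum_sub_distrib, Finset.sum_const,
      Finset.card_univ, Fintype.card_fin, nsmul_eq_mul] at agents_le
    rw [hφ, ← sub_div, ← sub_le_iff_le_add, le_div_iff₀ (by positivity)]
    linarith [sum_norm_mix_sub_sq_le hP (fun j => M j t) x]
  calc ∑ t ∈ Finset.Icc a b, ∑ i, inner ℝ (g i t) (M i t - x)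
      ≤ ∑ t ∈ Finset.Icc a b, ((φ t - φ (t + 1)) + m * (η * G ^ 2 / 2 + G * R)) :=
        Finset.sum_le_sum round_le
    _ = ∑ t ∈ Finset.Icc a b, (φ t - φ (t + 1)) +
          ((Finset.Icc a b).card : ℝ) * (m * (η * G ^ 2 / 2 + G * R)) := by
        rw [Finset.sum_add_distrib, Finset.sum_const, nsmul_eq_mul]
    _ ≤ φ a + ((Finset.Icc a b).card : ℝ) * (m * (η * G ^ 2 / 2 + G * R)) := by
        gcongr
        exact sum_Icc_sub_le (fun t => by positivity) a b

end IsProjectedDescent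

end ProjectedDescent

section Stability

variable {d d₁ d₂ : ℕ} {κ γ ρ δ : ℝ}

/-- `F` is similar to a matrix of norm at most `ρ`, through a transformation which, like its
inverse, has norm at most `κ`: the property strong stability requires of the closed loop, with a
free decay rate. -/
def IsSimilarToContraction (κ ρ : ℝ) (F : Matrix (Fin d) (Fin d) ℝ) : Prop :=
  ∃ L Q : Matrix (Fin d) (Fin d) ℝ,
    IsUnit Q.det ∧ F = Q * L * Q⁻¹ ∧ ‖L‖ ≤ ρ ∧ ‖Q‖ ≤ κ ∧ ‖Q⁻¹‖ ≤ κ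

variable {F : Matrix (Fin d) (Fin d) ℝ}

lemma IsSimilarToContraction.norm_pow_le (h : IsSimilarToContraction κ ρ F) (n : ℕ) :
    ‖F ^ n‖ ≤ κ ^ 2 * ρ ^ n := by
  obtain ⟨L, Q, hQ, rfl, hL, hQκ, hQκ'⟩ := h
  have conj_pow : (Q * L * Q⁻¹) ^ n = Q * L ^ n * Q⁻¹ := by
    obtain ⟨U, rfl⟩ := (Matrix.isUnit_iff_isUnit_det Q).2 hQ
    rw [← Matrix.coe_units_inv, Units.conj_pow]
  calc ‖(Q * L * Q⁻¹) ^ n‖ = ‖Q * L ^ n * Q⁻¹‖ := by rw [conj_pow]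
    _ ≤ κ * ρ ^ n * κ :=
        norm_matrixMul_le_of_le (norm_matrixMul_le_of_le hQκ (norm_pow_le_of_le hL n)) hQκ'
    _ = κ ^ 2 * ρ ^ n := by ring

lemma IsSimilarToContraction.of_norm_sub_le (h : IsSimilarToContraction κ ρ F)
    {G : Matrix (Fin d) (Fin d) ℝ} (hG : ‖G - F‖ ≤ δ) :
    IsSimilarToContraction κ (ρ + κ ^ 2 * δ) G := by
  obtain ⟨L, Q, hQ, rfl, hL, hQκ, hQκ'⟩ := h
  refine ⟨L + Q⁻¹ * (G - Q * L * Q⁻¹) * Q, Q, hQ, ?_, ?_, hQκ, hQκ'⟩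
  · calc G = Q * L * Q⁻¹ + (Q * Q⁻¹) * (G - Q * L * Q⁻¹) * (Q * Q⁻¹) := by
          rw [Matrix.mul_nonsing_inv Q hQ]; simp
      _ = Q * (L + Q⁻¹ * (G - Q * L * Q⁻¹) * Q) * Q⁻¹ := by
          simp only [Matrix.mul_add, Matrix.add_mul, Matrix.mul_assoc]
  · calc ‖L + Q⁻¹ * (G - Q * L * Q⁻¹) * Q‖ ≤ ρ + κ * δ * κ :=
          norm_add_le_of_le hL (norm_matrixMul_le_of_le (norm_matrixMul_le_of_le hQκ' hG) hQκ)
      _ = ρ + κ ^ 2 * δ := by ring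

/-- In the coordinates `Q⁻¹ x` the norm contracts by the factor `1 - γ` in each step. -/
lemma IsSimilarToContraction.norm_state_le (h : IsSimilarToContraction κ (1 - γ) F)
    (hγ : 0 < γ) {x r : ℤ → Vec d} {r₀ : ℝ} {N : ℤ} (hr₀ : 0 ≤ r₀) (hx₁ : x 1 = 0)
    (hx : ∀ t, 1 ≤ t → t < N → x (t + 1) = act F (x t) + r t)
    (hr : ∀ t, 1 ≤ t → t < N → ‖r t‖ ≤ r₀) {t : ℤ} (ht : 1 ≤ t) (htN : t ≤ N) :
    ‖x t‖ ≤ κ ^ 2 * r₀ / γ := by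
  obtain ⟨L, Q, hQ, rfl, hL, hQκ, hQκ'⟩ := h
  have hκ : 0 ≤ κ := (norm_nonneg Q).trans hQκ
  have intertwine : Q⁻¹ * (Q * L * Q⁻¹) = L * Q⁻¹ := by
    rw [← Matrix.mul_assoc, ← Matrix.mul_assoc, Matrix.nonsing_inv_mul Q hQ, Matrix.one_mul]
  have transformed_le : ‖act Q⁻¹ (x t)‖ ≤ κ * r₀ / γ := by
    induction t, ht using Int.leInduction with
    | base => rw [hx₁, act_zero, norm_zero]; positivity
    | succ t ht ih =>
      calc ‖act Q⁻¹ (x (t + 1))‖ = ‖act L (act Q⁻¹ (x t)) + act Q⁻¹ (r t)‖ := by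
            rw [hx t ht (by omega), act_add, act_act, act_act, intertwine]
        _ ≤ (1 - γ) * (κ * r₀ / γ) + κ * r₀ :=
            norm_add_le_of_le (norm_act_le_of_le hL (ih (by omega)))
              (norm_act_le_of_le hQκ' (hr t ht (by omega)))
        _ = κ * r₀ / γ := by field_simp; ring
  calc ‖x t‖ = ‖act Q (act Q⁻¹ (x t))‖ := by
        rw [act_act, Matrix.mul_nonsing_inv Q hQ, one_act]
    _ ≤ κ * (κ * r₀ / γ) := norm_act_le_of_le hQκ transformed_le
    _ = κ ^ 2 * r₀ / γ := by ring

lemma norm_closedLoop_sub_le {A A' : Matrix (Fin d₁) (Fin d₁) ℝ}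
    {B B' : Matrix (Fin d₁) (Fin d₂) ℝ} {K : Matrix (Fin d₂) (Fin d₁) ℝ} (hκ : 1 ≤ κ)
    (hK : ‖K‖ ≤ κ) (hA : ‖A - A'‖ ≤ δ) (hB : ‖B - B'‖ ≤ δ) :
    ‖(A - B * K) - (A' - B' * K)‖ ≤ 2 * κ * δ := by
  have hδ : 0 ≤ δ := (norm_nonneg _).trans hA
  calc ‖(A - B * K) - (A' - B' * K)‖ = ‖(A - A') - (B - B') * K‖ := by
        rw [Matrix.sub_mul, sub_sub_sub_comm]
    _ ≤ δ + δ * κ := norm_sub_le_of_le hA (norm_matrixMul_le_of_le hB hK)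
    _ ≤ 2 * κ * δ := by nlinarith

lemma StronglyStable.isSimilarToContraction {A : Matrix (Fin d₁) (Fin d₁) ℝ}
    {B : Matrix (Fin d₁) (Fin d₂) ℝ} {K : Matrix (Fin d₂) (Fin d₁) ℝ}
    (h : StronglyStable κ γ A B K) : IsSimilarToContraction κ (1 - γ) (A - B * K) :=
  h.2.2.2.2

lemma StronglyStable.norm_pow_le {A A' : Matrix (Fin d₁) (Fin d₁) ℝ}
    {B B' : Matrix (Fin d₁) (Fin d₂) ℝ} {K : Matrix (Fin d₂) (Fin d₁) ℝ}
    (h : StronglyStable κ γ A B K) (hκ : 1 ≤ κ) (hA : ‖A - A'‖ ≤ δ) (hB : ‖B - B'‖ ≤ δ)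
    (n : ℕ) : ‖(A' - B' * K) ^ n‖ ≤ κ ^ 2 * (1 - γ + 2 * κ ^ 3 * δ) ^ n := by
  have close : ‖(A' - B' * K) - (A - B * K)‖ ≤ 2 * κ * δ := by
    rw [norm_sub_rev]
    exact norm_closedLoop_sub_le hκ h.2.2.2.1 hA hB
  convert (h.isSimilarToContraction.of_norm_sub_le close).norm_pow_le n using 4
  ring

/-- The factor `G ^ p` makes the telescoping induction on `n` close. -/
lemma norm_pow_sub_pow_mul_pow_le {R : Type*} [NormedRing R] {F G : R} {a : ℝ}
    (hF : ∀ n, ‖F ^ n‖ ≤ a * ρ ^ n) (hG : ∀ n, ‖G ^ n‖ ≤ a * ρ ^ n) (hFG : ‖F - G‖ ≤ δ)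
    (n p : ℕ) : ‖(F ^ n - G ^ n) * G ^ p‖ ≤ a ^ 2 * δ * (n * ρ ^ (n + p - 1)) := by
  induction n generalizing p with
  | zero => simp
  | succ n ih =>
    have telescope : (F ^ (n + 1) - G ^ (n + 1)) * G ^ p =
        F ^ n * (F - G) * G ^ p + (F ^ n - G ^ n) * G ^ (p + 1) := by
      rw [pow_succ F, pow_succ G n, pow_succ' G p]; noncomm_ring
    calc ‖(F ^ (n + 1) - G ^ (n + 1)) * G ^ p‖
        = ‖F ^ n * (F - G) * G ^ p + (F ^ n - G ^ n) * G ^ (p + 1)‖ := by rw [telescope]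
      _ ≤ (a * ρ ^ n) * δ * (a * ρ ^ p) + a ^ 2 * δ * (n * ρ ^ (n + (p + 1) - 1)) :=
          norm_add_le_of_le (norm_mul_le_of_le (norm_mul_le_of_le (hF n) hFG) (hG p)) (ih (p + 1))
      _ = a ^ 2 * δ * ((n + 1 : ℕ) * ρ ^ (n + 1 + p - 1)) := by
          rw [show n + (p + 1) - 1 = n + p by omega, show n + 1 + p - 1 = n + p by omega]
          push_cast; ring

lemma norm_pow_sub_pow_le {R : Type*} [NormedRing R] {F G : R} {a : ℝ}
    (hF : ∀ n, ‖F ^ n‖ ≤ a * ρ ^ n) (hG : ∀ n, ‖G ^ n‖ ≤ a * ρ ^ n) (hFG : ‖F - G‖ ≤ δ)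
    (n : ℕ) : ‖F ^ n - G ^ n‖ ≤ a ^ 2 * δ * (n * ρ ^ (n - 1)) := by
  simpa using norm_pow_sub_pow_mul_pow_le hF hG hFG n 0

end Stability

section Feedback

variable {H d₁ d₂ : ℕ} {κ γ ω : ℝ} {w : ℤ → Vec d₁} {s : ℤ}

/-- The disturbance feedback `∑_{k=1}^{H} M^[k-1] w_{s-k}` at time `s`, as a linear map of the
policy `M`. -/
def feedback (w : ℤ → Vec d₁) (s : ℤ) : Param H d₁ d₂ →ₗ[ℝ] Vec d₂ where
  toFun M := ∑ k : Fin H, act (block M k) (w (s - 1 - ((k : ℕ) : ℤ)))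
  map_add' M N := by simp only [block_add, add_act, Finset.sum_add_distrib]
  map_smul' r M := by simp only [block_smul, smul_act, Finset.smul_sum, RingHom.id_apply]

lemma feedback_apply (w : ℤ → Vec d₁) (s : ℤ) (M : Param H d₁ d₂) :
    feedback w s M = ∑ k : Fin H, act (block M k) (w (s - 1 - ((k : ℕ) : ℤ))) := rfl

lemma feedback_sub_disturbance (w w' : ℤ → Vec d₁) (s : ℤ) (M : Param H d₁ d₂) :
    feedback (w - w') s M = feedback w s M - feedback w' s M := by
  simp only [feedback_apply, Pi.sub_apply, act_sub, Finset.sum_sub_distrib]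

lemma feedback_eq_zero (hw : ∀ r < s, w r = 0) (M : Param H d₁ d₂) : feedback w s M = 0 := by
  rw [feedback_apply]
  exact Finset.sum_eq_zero fun k _ => by rw [hw _ (by omega), act_zero]

lemma norm_feedback_le_sum (hw : ∀ r < s, ‖w r‖ ≤ ω) (M : Param H d₁ d₂) :
    ‖feedback w s M‖ ≤ (∑ k : Fin H, ‖block M k‖) * ω := by
  rw [Finset.sum_mul]
  exact norm_sum_le_of_le _ fun k _ => norm_act_le_of_le le_rfl (hw _ (by omega))

lemma norm_feedback_le (hw : ∀ r < s, ‖w r‖ ≤ ω) (M : Param H d₁ d₂) :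
    ‖feedback w s M‖ ≤ √(H : ℝ) * ‖M‖ * ω := by
  have hω : 0 ≤ ω := (norm_nonneg _).trans (hw (s - 1) (by omega))
  refine (norm_feedback_le_sum hw M).trans ?_
  gcongr
  exact sum_norm_block_le M

lemma norm_feedback_le_of_mem_policySet (hκ : 0 ≤ κ) (hγ : 0 < γ) (hγ1 : γ ≤ 1)
    (hw : ∀ r < s, ‖w r‖ ≤ ω) {M : Param H d₁ d₂} (hM : M ∈ policySet H d₁ d₂ κ γ) :
    ‖feedback w s M‖ ≤ 2 * κ ^ 3 * ω / γ := by
  have hω : 0 ≤ ω := (norm_nonneg _).trans (hw (s - 1) (by omega))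
  calc ‖feedback w s M‖ ≤ (∑ k : Fin H, ‖block M k‖) * ω := norm_feedback_le_sum hw M
    _ ≤ 2 * κ ^ 3 / γ * ω := by
        gcongr; exact sum_norm_block_le_of_mem_policySet hγ hγ1 hκ hM
    _ = 2 * κ ^ 3 * ω / γ := by ring

lemma norm_feedback_le_card_of_mem_policySet (hκ : 0 ≤ κ) (hγ : 0 < γ) (hγ1 : γ ≤ 1)
    (hw : ∀ r < s, ‖w r‖ ≤ ω) {M : Param H d₁ d₂} (hM : M ∈ policySet H d₁ d₂ κ γ) :
    ‖feedback w s M‖ ≤ 2 * κ ^ 3 * ω * H := by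
  have hω : 0 ≤ ω := (norm_nonneg _).trans (hw (s - 1) (by omega))
  have block_le (k : Fin H) : ‖block M k‖ ≤ 2 * κ ^ 3 :=
    (hM k).trans (mul_le_of_le_one_right (by positivity)
      (pow_le_one₀ (by linarith) (by linarith)))
  calc ‖feedback w s M‖ ≤ (∑ k : Fin H, ‖block M k‖) * ω := norm_feedback_le_sum hw M
    _ ≤ (∑ _k : Fin H, 2 * κ ^ 3) * ω := by gcongr with k; exact block_le k
    _ = 2 * κ ^ 3 * ω * H := by
        rw [Finset.sum_const, Finset.card_univ, Fintype.card_fin, nsmul_eq_mul]; ring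

end Feedback

section SurrogateState

variable {H d₁ d₂ : ℕ} (A : Matrix (Fin d₁) (Fin d₁) ℝ) (B : Matrix (Fin d₁) (Fin d₂) ℝ)
  (K : Matrix (Fin d₂) (Fin d₁) ℝ) (w : ℤ → Vec d₁)

lemma surrogateAction_eq (M : ℤ → Param H d₁ d₂) (t : ℤ) :
    surrogateAction A B K w M t = -act K (surrogateState A B K w M t) + feedback w t (M t) := rfl

lemma act_transferMatrix (M : ℤ → Param H d₁ d₂) (t : ℤ) (i : ℕ) (x : Vec d₁) :
    act (transferMatrix A B K H M t i) x =
      (if i ≤ H then act ((A - B * K) ^ i) x else 0) +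
        ∑ n ∈ Finset.range (H + 1), ∑ k : Fin H, if i = n + (k : ℕ) + 1 then
          act ((A - B * K) ^ n * B) (act (block (M (t - (n : ℤ))) k) x) else 0 := by
  simp only [transferMatrix, add_act, sum_act, act_act, apply_ite (act · x), zero_act]

/-- Reindexing by the age `n = j` of the control which transmits a disturbance, the surrogate state
is the response of the closed loop, truncated to its last `H + 1` inputs. -/
theorem surrogateState_eq_sum (M : ℤ → Param H d₁ d₂) (t : ℤ) :
    surrogateState A B K w M t =
      ∑ n ∈ Finset.range (H + 1), (act ((A - B * K) ^ n) (w (t - 1 - (n : ℤ))) +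
        act ((A - B * K) ^ n * B) (feedback w (t - 1 - (n : ℤ)) (M (t - 1 - (n : ℤ))))) := by
  simp only [surrogateState, act_transferMatrix, Finset.sum_add_distrib]
  congr 1
  · rw [← Finset.sum_filter]
    refine Finset.sum_congr ?_ fun _ _ => rfl
    ext n
    simp only [Finset.mem_filter, Finset.mem_range]
    omega
  · rw [Finset.sum_comm]
    refine Finset.sum_congr rfl fun n hn => ?_
    rw [Finset.sum_comm, feedback_apply, act_sum]
    refine Finset.sum_congr rfl fun k _ => ?_
    have in_range : n + (k : ℕ) + 1 ∈ Finset.range (2 * H + 1) := by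
      have := k.isLt
      have := Finset.mem_range.1 hn
      exact Finset.mem_range.2 (by omega)
    rw [Finset.sum_ite_eq' _ _ _, if_pos in_range]
    congr 3
    push_cast; ring

end SurrogateState

section StableLoop

variable {H d₁ d₂ : ℕ} {A A' : Matrix (Fin d₁) (Fin d₁) ℝ} {B B' : Matrix (Fin d₁) (Fin d₂) ℝ}
  {K : Matrix (Fin d₂) (Fin d₁) ℝ} {w w' : ℤ → Vec d₁} {t : ℤ} {κ ρ b ω : ℝ}

/-- The closed loop `A - B K` has powers decaying at the rate `ρ`. This is what is left of strong
stability of a nearby system, and all that the surrogate costs need. -/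
structure IsStableLoop (κ ρ b : ℝ) (A : Matrix (Fin d₁) (Fin d₁) ℝ)
    (B : Matrix (Fin d₁) (Fin d₂) ℝ) (K : Matrix (Fin d₂) (Fin d₁) ℝ) : Prop where
  one_le : 1 ≤ κ
  rate_nonneg : 0 ≤ ρ
  rate_lt_one : ρ < 1
  norm_gain_le : ‖K‖ ≤ κ
  norm_input_le : ‖B‖ ≤ b
  norm_pow_le : ∀ n, ‖(A - B * K) ^ n‖ ≤ κ ^ 2 * ρ ^ n

namespace IsStableLoop

lemma kappa_nonneg (h : IsStableLoop κ ρ b A B K) : 0 ≤ κ := zero_le_one.trans h.one_le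

lemma bound_nonneg (h : IsStableLoop κ ρ b A B K) : 0 ≤ b := (norm_nonneg B).trans h.norm_input_le

lemma one_sub_pos (h : IsStableLoop κ ρ b A B K) : 0 < 1 - ρ := sub_pos.2 h.rate_lt_one

lemma norm_surrogateState_le (h : IsStableLoop κ ρ b A B K) {M : ℤ → Param H d₁ d₂} {φ : ℝ}
    (hω : 0 ≤ ω) (hφ : 0 ≤ φ) (hw : ∀ s < t, ‖w s‖ ≤ ω) (hM : ∀ s < t, ‖feedback w s (M s)‖ ≤ φ) :
    ‖surrogateState A B K w M t‖ ≤ (κ ^ 2 * ω + κ ^ 2 * b * φ) / (1 - ρ) := by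
  have hb := h.bound_nonneg
  rw [surrogateState_eq_sum]
  calc _ ≤ ∑ n ∈ Finset.range (H + 1), (κ ^ 2 * ρ ^ n * ω + κ ^ 2 * ρ ^ n * b * φ) :=
        norm_sum_le_of_le _ fun n _ => norm_add_le_of_le
          (norm_act_le_of_le (h.norm_pow_le n) (hw _ (by omega)))
          (norm_act_le_of_le (norm_matrixMul_le_of_le (h.norm_pow_le n) h.norm_input_le)
            (hM _ (by omega)))
    _ = (κ ^ 2 * ω + κ ^ 2 * b * φ) * ∑ n ∈ Finset.range (H + 1), ρ ^ n := by
        rw [Finset.mul_sum]; exact Finset.sum_congr rfl fun _ _ => by ring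
    _ ≤ (κ ^ 2 * ω + κ ^ 2 * b * φ) * (1 / (1 - ρ)) := by
        gcongr; exact sum_range_pow_le h.rate_nonneg h.rate_lt_one _
    _ = (κ ^ 2 * ω + κ ^ 2 * b * φ) / (1 - ρ) := mul_one_div _ _

lemma norm_surrogateState_sub_le_sum (h : IsStableLoop κ ρ b A B K) {M N : ℤ → Param H d₁ d₂}
    {φ : ℝ} (hMN : ∀ s, t - (H + 1) ≤ s → s < t → ‖feedback w s (M s - N s)‖ ≤ φ) :
    ‖surrogateState A B K w M t - surrogateState A B K w N t‖ ≤
      κ ^ 2 * b * φ * ∑ n ∈ Finset.range (H + 1), ρ ^ n := by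
  rw [surrogateState_eq_sum, surrogateState_eq_sum, ← Finset.sum_sub_distrib, Finset.mul_sum]
  refine norm_sum_le_of_le _ fun n hn => ?_
  rw [add_sub_add_left_eq_sub, ← act_sub, ← map_sub]
  have recent : t - (H + 1) ≤ t - 1 - (n : ℤ) := by
    have := Finset.mem_range.1 hn
    omega
  calc _ ≤ κ ^ 2 * ρ ^ n * b * φ :=
        norm_act_le_of_le (norm_matrixMul_le_of_le (h.norm_pow_le n) h.norm_input_le)
          (hMN _ recent (by omega))
    _ = κ ^ 2 * b * φ * ρ ^ n := by ring

lemma norm_response_sub_le (h : IsStableLoop κ ρ b A B K) (h' : IsStableLoop κ ρ b A' B' K)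
    {δF δB δw φ δφ : ℝ} (hF : ‖(A - B * K) - (A' - B' * K)‖ ≤ δF) (hB : ‖B - B'‖ ≤ δB)
    {x x' : Vec d₁} {v v' : Vec d₂} (hx : ‖x‖ ≤ ω) (hv : ‖v‖ ≤ φ) (hxx' : ‖x - x'‖ ≤ δw)
    (hvv' : ‖v - v'‖ ≤ δφ) (n : ℕ) :
    ‖(act ((A - B * K) ^ n) x + act ((A - B * K) ^ n * B) v) -
        (act ((A' - B' * K) ^ n) x' + act ((A' - B' * K) ^ n * B') v')‖ ≤
      κ ^ 4 * δF * (ω + b * φ) * (n * ρ ^ (n - 1)) +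
        κ ^ 2 * (δB * φ + δw + b * δφ) * ρ ^ n := by
  set F := A - B * K
  set F' := A' - B' * K
  have hpow := norm_pow_sub_pow_le h.norm_pow_le h'.norm_pow_le hF n
  have split : act (F ^ n) x + act (F ^ n * B) v - (act (F' ^ n) x' + act (F' ^ n * B') v') =
      (act (F ^ n - F' ^ n) x + act ((F ^ n - F' ^ n) * B) v) +
        (act (F' ^ n * (B - B')) v + (act (F' ^ n) (x - x') + act (F' ^ n * B') (v - v'))) := by
    simp only [sub_act, act_sub, Matrix.sub_mul, Matrix.mul_sub]
    abel
  rw [split]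
  calc _ ≤ ((κ ^ 2) ^ 2 * δF * (n * ρ ^ (n - 1)) * ω +
          (κ ^ 2) ^ 2 * δF * (n * ρ ^ (n - 1)) * b * φ) +
        (κ ^ 2 * ρ ^ n * δB * φ + (κ ^ 2 * ρ ^ n * δw + κ ^ 2 * ρ ^ n * b * δφ)) :=
        norm_add_le_of_le
          (norm_add_le_of_le (norm_act_le_of_le hpow hx)
            (norm_act_le_of_le (norm_matrixMul_le_of_le hpow h.norm_input_le) hv))
          (norm_add_le_of_le
            (norm_act_le_of_le (norm_matrixMul_le_of_le (h'.norm_pow_le n) hB) hv)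
            (norm_add_le_of_le (norm_act_le_of_le (h'.norm_pow_le n) hxx')
              (norm_act_le_of_le
                (norm_matrixMul_le_of_le (h'.norm_pow_le n) h'.norm_input_le) hvv')))
    _ = _ := by ring

end IsStableLoop

end StableLoop

section SystemPerturbation

variable {H d₁ d₂ : ℕ} {A A' : Matrix (Fin d₁) (Fin d₁) ℝ} {B B' : Matrix (Fin d₁) (Fin d₂) ℝ}
  {K : Matrix (Fin d₂) (Fin d₁) ℝ} {w w' : ℤ → Vec d₁} {t : ℤ} {κ γ ρ b ω δ δw : ℝ}

/-- The change of the surrogate state when the system matrices change by at most `δ` and the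
disturbances, bounded by `ω`, change by at most `δw`. -/
noncomputable def stateDeviation (H : ℕ) (κ ρ b ω δ δw : ℝ) : ℝ :=
  2 * κ ^ 5 * δ * ω / (1 - ρ) ^ 2 + 4 * κ ^ 8 * H ^ 2 * b * δ * ω / (1 - ρ) +
    2 * κ ^ 5 * H * δ * ω / (1 - ρ) + (κ ^ 2 + 2 * H * b * κ ^ 5) / (1 - ρ) * δw

theorem IsStableLoop.norm_surrogateState_sub_le_stateDeviation (h : IsStableLoop κ ρ b A B K)
    (h' : IsStableLoop κ ρ b A' B' K) (hγ : 0 < γ) (hγ1 : γ ≤ 1) (hA : ‖A - A'‖ ≤ δ)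
    (hB : ‖B - B'‖ ≤ δ) (hw : ∀ s < t, ‖w s‖ ≤ ω) (hww' : ∀ s < t, ‖w s - w' s‖ ≤ δw)
    {M : Param H d₁ d₂} (hM : M ∈ policySet H d₁ d₂ κ γ) :
    ‖surrogateState A B K w (fun _ => M) t - surrogateState A' B' K w' (fun _ => M) t‖ ≤
      stateDeviation H κ ρ b ω δ δw := by
  have hκ := h.kappa_nonneg
  have hb := h.bound_nonneg
  have hρ := h.rate_nonneg
  have := h.one_sub_pos
  have hω : 0 ≤ ω := (norm_nonneg _).trans (hw (t - 1) (by omega))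
  have hδw : 0 ≤ δw := (norm_nonneg _).trans (hww' (t - 1) (by omega))
  have hδ : 0 ≤ δ := (norm_nonneg _).trans hA
  have hF : ‖(A - B * K) - (A' - B' * K)‖ ≤ 2 * κ * δ :=
    norm_closedLoop_sub_le h.one_le h.norm_gain_le hA hB
  rw [surrogateState_eq_sum, surrogateState_eq_sum, ← Finset.sum_sub_distrib]
  calc _ ≤ ∑ n ∈ Finset.range (H + 1), (κ ^ 4 * (2 * κ * δ) * ω * (n * ρ ^ (n - 1)) +
          κ ^ 4 * (2 * κ * δ) * b * (2 * κ ^ 3 * ω * H) * (n * ρ ^ (n - 1)) +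
          κ ^ 2 * (δ * (2 * κ ^ 3 * ω * H) + δw + b * (2 * κ ^ 3 * δw * H)) * ρ ^ n) := by
        refine norm_sum_le_of_le _ fun n _ => ?_
        have feedback_le := norm_feedback_le_card_of_mem_policySet hκ hγ hγ1
          (s := t - 1 - (n : ℤ)) (fun r hr => hw r (by omega)) hM
        have feedback_sub_le := norm_feedback_le_card_of_mem_policySet hκ hγ hγ1
          (w := w - w') (s := t - 1 - (n : ℤ)) (fun r hr => hww' r (by omega)) hM
        rw [feedback_sub_disturbance] at feedback_sub_le
        refine (h.norm_response_sub_le h' hF hB (hw _ (by omega)) feedback_le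
          (hww' _ (by omega)) feedback_sub_le n).trans_eq ?_
        ring
    _ ≤ κ ^ 4 * (2 * κ * δ) * ω * (1 / (1 - ρ) ^ 2) +
          κ ^ 4 * (2 * κ * δ) * b * (2 * κ ^ 3 * ω * H) * (H / (1 - ρ)) +
          κ ^ 2 * (δ * (2 * κ ^ 3 * ω * H) + δw + b * (2 * κ ^ 3 * δw * H)) * (1 / (1 - ρ)) := by
        simp only [Finset.sum_add_distrib, ← Finset.mul_sum]
        gcongr
        · exact sum_range_mul_pow_pred_le hρ h.rate_lt_one _
        · exact sum_range_mul_pow_pred_le_mul hρ h.rate_lt_one _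
        · exact sum_range_pow_le hρ h.rate_lt_one _
    _ = stateDeviation H κ ρ b ω δ δw := by rw [stateDeviation]; ring

end SystemPerturbation

section Costs

section FirstOrder

variable {E F : Type*} [NormedAddCommGroup E] [InnerProductSpace ℝ E] [CompleteSpace E]
  [NormedAddCommGroup F] [InnerProductSpace ℝ F]

lemma norm_gradient_eq_norm_fderiv (f : E → ℝ) (x : E) : ‖gradient f x‖ = ‖fderiv ℝ f x‖ := by
  rw [← toDual_gradient, LinearIsometryEquiv.norm_map]

lemma sub_le_inner_gradient_of_convexOn {f : E → ℝ} (hf : ConvexOn ℝ Set.univ f) {x : E}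
    (hfx : DifferentiableAt ℝ f x) (y : E) : f x - f y ≤ inner ℝ (gradient f x) (x - y) := by
  have line_convex : ConvexOn ℝ Set.univ (f ∘ AffineMap.lineMap (k := ℝ) x y) :=
    hf.comp_affineMap _
  have line_deriv : HasDerivAt (f ∘ AffineMap.lineMap (k := ℝ) x y) (fderiv ℝ f x (y - x)) 0 := by
    refine HasFDerivAt.comp_hasDerivAt _ ?_ AffineMap.hasDerivAt_lineMap
    rw [AffineMap.lineMap_apply_zero]
    exact hfx.hasFDerivAt
  have slope_le := line_convex.le_slope_of_hasDerivAt (Set.mem_univ 0) (Set.mem_univ 1)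
    zero_lt_one line_deriv
  rw [slope_def_field, sub_zero, div_one, Function.comp_apply, Function.comp_apply,
    AffineMap.lineMap_apply_zero, AffineMap.lineMap_apply_one] at slope_le
  rw [← neg_sub y x, inner_neg_right, inner_gradient_left]
  linarith

lemma norm_gradient_comp_affine_le [FiniteDimensional ℝ E] [CompleteSpace F] {c : F → ℝ} {p : F}
    {L : E →ₗ[ℝ] F} {x : E} (hc : DifferentiableAt ℝ c (p + L x)) {ℓ : ℝ} (hℓ : 0 ≤ ℓ)
    (hL : ∀ v, ‖L v‖ ≤ ℓ * ‖v‖) :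
    ‖gradient (fun v => c (p + L v)) x‖ ≤ ‖gradient c (p + L x)‖ * ℓ := by
  have deriv_eq : HasFDerivAt (fun v => c (p + L v))
      ((fderiv ℝ c (p + L x)).comp (LinearMap.toContinuousLinearMap L)) x :=
    hc.hasFDerivAt.comp x ((LinearMap.toContinuousLinearMap L).hasFDerivAt.const_add p)
  rw [norm_gradient_eq_norm_fderiv, norm_gradient_eq_norm_fderiv, deriv_eq.fderiv]
  refine (ContinuousLinearMap.opNorm_comp_le _ _).trans ?_
  gcongr
  exact ContinuousLinearMap.opNorm_le_bound _ hℓ hL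

lemma sub_le_inner_gradient_comp_affine [FiniteDimensional ℝ E] {c : F → ℝ}
    (hc : ConvexOn ℝ Set.univ c) (hd : Differentiable ℝ c) (p : F) (L : E →ₗ[ℝ] F) (x y : E) :
    c (p + L x) - c (p + L y) ≤ inner ℝ (gradient (fun v => c (p + L v)) x) (x - y) := by
  refine sub_le_inner_gradient_of_convexOn (f := fun v => c (p + L v)) ?_ ?_ y
  · exact (hc.translate_right p).comp_linearMap L
  · exact (hd _).comp x ((LinearMap.toContinuousLinearMap L).differentiableAt.const_add p)

end FirstOrder

variable {d₁ d₂ : ℕ}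

lemma norm_stateAction_le (z : StateAction d₁ d₂) : ‖z‖ ≤ ‖z.fst‖ + ‖z.snd‖ := by
  refine le_of_sq_le_sq ?_ (by positivity)
  rw [WithLp.prod_norm_sq_eq_of_L2, add_sq]
  have : 0 ≤ 2 * ‖z.fst‖ * ‖z.snd‖ := by positivity
  linarith

lemma convex_norm_fst_snd_le (D : ℝ) :
    Convex ℝ {z : StateAction d₁ d₂ | ‖z.fst‖ ≤ D ∧ ‖z.snd‖ ≤ D} := by
  have fst_convex := (convex_closedBall (0 : Vec d₁) D).linear_preimage
    (WithLp.fstₗ 2 ℝ (Vec d₁) (Vec d₂))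
  have snd_convex := (convex_closedBall (0 : Vec d₂) D).linear_preimage
    (WithLp.sndₗ 2 ℝ (Vec d₁) (Vec d₂))
  simpa [Set.preimage, Set.ofPred_and] using fst_convex.inter snd_convex

lemma CostAssumption.nonneg {Gc : ℝ} {c : StateAction d₁ d₂ → ℝ} (hc : CostAssumption Gc c) :
    0 ≤ Gc := by
  simpa using (norm_nonneg _).trans (hc.2.2 1 0 (by simp) (by simp))

lemma CostAssumption.sub_le {Gc D : ℝ} {c : StateAction d₁ d₂ → ℝ} (hc : CostAssumption Gc c)
    {z z' : StateAction d₁ d₂} (hz₁ : ‖z.fst‖ ≤ D) (hz₂ : ‖z.snd‖ ≤ D) (hz'₁ : ‖z'.fst‖ ≤ D)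
    (hz'₂ : ‖z'.snd‖ ≤ D) : c z - c z' ≤ Gc * D * ‖z - z'‖ :=
  (le_abs_self _).trans <|
    (convex_norm_fst_snd_le D).norm_image_sub_le_of_norm_fderiv_le (fun x _ => hc.2.1 x)
      (fun x hx => by rw [← norm_gradient_eq_norm_fderiv]; exact hc.2.2 D x hx.1 hx.2)
      ⟨hz'₁, hz'₂⟩ ⟨hz₁, hz₂⟩

end Costs

section SurrogatePair

variable {H d₁ d₂ : ℕ}

/-- The surrogate state and action as one vector, the argument of the cost. -/
def surrogatePair (A : Matrix (Fin d₁) (Fin d₁) ℝ) (B : Matrix (Fin d₁) (Fin d₂) ℝ)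
    (K : Matrix (Fin d₂) (Fin d₁) ℝ) (w : ℤ → Vec d₁) (M : ℤ → Param H d₁ d₂) (t : ℤ) :
    StateAction d₁ d₂ :=
  WithLp.toLp 2 (surrogateState A B K w M t, surrogateAction A B K w M t)

/-- The linear part of the surrogate state as a function of a time-invariant policy. -/
noncomputable def constPolicyState (A : Matrix (Fin d₁) (Fin d₁) ℝ)
    (B : Matrix (Fin d₁) (Fin d₂) ℝ) (K : Matrix (Fin d₂) (Fin d₁) ℝ) (w : ℤ → Vec d₁) (t : ℤ) :
    Param H d₁ d₂ →ₗ[ℝ] Vec d₁ :=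
  ∑ n ∈ Finset.range (H + 1),
    Matrix.toEuclideanLin ((A - B * K) ^ n * B) ∘ₗ feedback w (t - 1 - (n : ℤ))

/-- The linear part of the surrogate state and action as a function of a time-invariant policy. -/
noncomputable def constPolicyPair (A : Matrix (Fin d₁) (Fin d₁) ℝ)
    (B : Matrix (Fin d₁) (Fin d₂) ℝ) (K : Matrix (Fin d₂) (Fin d₁) ℝ) (w : ℤ → Vec d₁) (t : ℤ) :
    Param H d₁ d₂ →ₗ[ℝ] StateAction d₁ d₂ :=
  (WithLp.linearEquiv 2 ℝ (Vec d₁ × Vec d₂)).symm.toLinearMap ∘ₗ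
    (constPolicyState A B K w t).prod
      (feedback w t - Matrix.toEuclideanLin K ∘ₗ constPolicyState A B K w t)

section Linearity

variable (A : Matrix (Fin d₁) (Fin d₁) ℝ) (B : Matrix (Fin d₁) (Fin d₂) ℝ)
  (K : Matrix (Fin d₂) (Fin d₁) ℝ) (w : ℤ → Vec d₁) (M : Param H d₁ d₂) (t : ℤ)

lemma surrogateState_const :
    surrogateState A B K w (fun _ => M) t =
      surrogateState A B K w (fun _ => (0 : Param H d₁ d₂)) t + constPolicyState A B K w t M := by
  simp only [surrogateState_eq_sum, constPolicyState, map_zero, add_zero,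
    Finset.sum_add_distrib, LinearMap.sum_apply, LinearMap.comp_apply, act_eq_toEuclideanLin]

lemma surrogatePair_const :
    surrogatePair A B K w (fun _ => M) t =
      surrogatePair A B K w (fun _ => (0 : Param H d₁ d₂)) t + constPolicyPair A B K w t M := by
  have action_eq : surrogateAction A B K w (fun _ => M) t =
      surrogateAction A B K w (fun _ => (0 : Param H d₁ d₂)) t +
        (feedback w t M - act K (constPolicyState A B K w t M)) := by
    simp only [surrogateAction_eq, surrogateState_const A B K w M t, act_add, map_zero]
    abel
  simp only [surrogatePair, surrogateState_const A B K w M t, action_eq]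
  rfl

lemma surrogateCost_sub_le_inner_gradient {Gc : ℝ} {c : StateAction d₁ d₂ → ℝ}
    (hc : CostAssumption Gc c) (N : Param H d₁ d₂) :
    surrogateCost c A B K w t (fun _ => M) - surrogateCost c A B K w t (fun _ => N) ≤
      inner ℝ (gradient (fun M : Param H d₁ d₂ => surrogateCost c A B K w t fun _ => M) M)
        (M - N) := by
  have first_order := sub_le_inner_gradient_comp_affine hc.1 hc.2.1
    (surrogatePair A B K w (fun _ => (0 : Param H d₁ d₂)) t) (constPolicyPair A B K w t) M N
  simp only [← surrogatePair_const] at first_order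
  exact first_order

end Linearity

variable {A A' : Matrix (Fin d₁) (Fin d₁) ℝ} {B B' : Matrix (Fin d₁) (Fin d₂) ℝ}
  {K : Matrix (Fin d₂) (Fin d₁) ℝ} {w w' : ℤ → Vec d₁} {t : ℤ}
  {κ γ ρ b ω δ δw Gc : ℝ} {c : StateAction d₁ d₂ → ℝ}

lemma norm_surrogatePair_sub_le (hκ : 1 ≤ κ) (hK : ‖K‖ ≤ κ) (M N : ℤ → Param H d₁ d₂) :
    ‖surrogatePair A B K w M t - surrogatePair A' B' K w' N t‖ ≤
      2 * κ * ‖surrogateState A B K w M t - surrogateState A' B' K w' N t‖ +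
        ‖feedback w t (M t) - feedback w' t (N t)‖ := by
  set z := surrogatePair A B K w M t - surrogatePair A' B' K w' N t
  set Δy := surrogateState A B K w M t - surrogateState A' B' K w' N t with Δy_def
  set Δv := feedback w t (M t) - feedback w' t (N t) with Δv_def
  have fst_eq : z.fst = Δy := rfl
  have snd_eq : z.snd = Δv - act K Δy := by
    have : z.snd = surrogateAction A B K w M t - surrogateAction A' B' K w' N t := rfl
    rw [this, surrogateAction_eq, surrogateAction_eq, Δy_def, Δv_def, act_sub]
    abel
  calc ‖z‖ ≤ ‖Δy‖ + ‖Δv - act K Δy‖ := by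
        rw [← snd_eq, ← fst_eq]; exact norm_stateAction_le z
    _ ≤ ‖Δy‖ + (‖Δv‖ + κ * ‖Δy‖) := by
        gcongr
        exact norm_sub_le_of_le le_rfl (norm_act_le_of_le hK le_rfl)
    _ ≤ 2 * κ * ‖Δy‖ + ‖Δv‖ := by nlinarith [norm_nonneg Δy]

/-- A bound for the surrogate states and actions of feasible policies. -/
noncomputable def surrogateRadius (H : ℕ) (κ γ ρ b ω : ℝ) : ℝ :=
  κ * (ω * (κ ^ 2 + 2 * H * b * κ ^ 5) / (1 - ρ) + 2 * ω * κ ^ 3 / γ)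

/-- Up to the factor `2 √H`, the Lipschitz constant of the surrogate state and action in a
time-invariant policy. -/
noncomputable def policySensitivity (κ ρ b ω : ℝ) : ℝ := κ ^ 3 * b * ω / (1 - ρ) + ω

/-- Half of a bound for the change of the surrogate state and action when the system matrices change
by `δ` and the disturbances by `δw`. -/
noncomputable def systemSensitivity (H : ℕ) (κ γ ρ b ω δ δw : ℝ) : ℝ :=
  κ * stateDeviation H κ ρ b ω δ δw + κ ^ 3 * δw / γ

namespace IsStableLoop

lemma policySensitivity_nonneg (h : IsStableLoop κ ρ b A B K) (hω : 0 ≤ ω) :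
    0 ≤ policySensitivity κ ρ b ω := by
  have := h.kappa_nonneg
  have := h.bound_nonneg
  have := h.one_sub_pos
  unfold policySensitivity
  positivity

lemma surrogateRadius_nonneg (h : IsStableLoop κ ρ b A B K) (hγ : 0 < γ) (hω : 0 ≤ ω) :
    0 ≤ surrogateRadius H κ γ ρ b ω := by
  have := h.kappa_nonneg
  have := h.bound_nonneg
  have := h.one_sub_pos
  unfold surrogateRadius
  positivity

/-- Policies may be infeasible as long as only zero disturbances reach them, as happens before the
learning phase. -/
lemma norm_surrogatePair_le (h : IsStableLoop κ ρ b A B K) (hγ : 0 < γ) (hγ1 : γ ≤ 1)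
    (hw : ∀ s < t, ‖w s‖ ≤ ω) {M : ℤ → Param H d₁ d₂}
    (hM : ∀ s ≤ t, (∀ r < s, w r = 0) ∨ M s ∈ policySet H d₁ d₂ κ γ) :
    ‖surrogateState A B K w M t‖ ≤ surrogateRadius H κ γ ρ b ω ∧
      ‖surrogateAction A B K w M t‖ ≤ surrogateRadius H κ γ ρ b ω := by
  have hκ := h.kappa_nonneg
  have hκ1 := h.one_le
  have hb := h.bound_nonneg
  have hρ := h.one_sub_pos
  have hω : 0 ≤ ω := (norm_nonneg _).trans (hw (t - 1) (by omega))
  have feedback_le_card (s : ℤ) (hs : s ≤ t) : ‖feedback w s (M s)‖ ≤ 2 * κ ^ 3 * ω * H := by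
    rcases hM s hs with no_disturbance | feasible
    · rw [feedback_eq_zero no_disturbance, norm_zero]; positivity
    · exact norm_feedback_le_card_of_mem_policySet hκ hγ hγ1 (fun r hr => hw r (by omega)) feasible
  have feedback_le : ‖feedback w t (M t)‖ ≤ 2 * ω * κ ^ 3 / γ := by
    rcases hM t le_rfl with no_disturbance | feasible
    · rw [feedback_eq_zero no_disturbance, norm_zero]; positivity
    · exact (norm_feedback_le_of_mem_policySet hκ hγ hγ1 hw feasible).trans_eq (by ring)
  have state_le : ‖surrogateState A B K w M t‖ ≤
      ω * (κ ^ 2 + 2 * H * b * κ ^ 5) / (1 - ρ) :=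
    (h.norm_surrogateState_le hω (by positivity) hw
      fun s hs => feedback_le_card s hs.le).trans_eq (by ring)
  set y := ω * (κ ^ 2 + 2 * H * b * κ ^ 5) / (1 - ρ)
  set v := 2 * ω * κ ^ 3 / γ
  have hy : 0 ≤ y := by positivity
  have hv : 0 ≤ v := by positivity
  have radius_eq : surrogateRadius H κ γ ρ b ω = κ * (y + v) := rfl
  rw [radius_eq]
  constructor
  · nlinarith
  · calc ‖surrogateAction A B K w M t‖ ≤ κ * y + v := by
          rw [surrogateAction_eq]
          refine norm_add_le_of_le ?_ feedback_le
          rw [norm_neg]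
          exact norm_act_le_of_le h.norm_gain_le state_le
      _ ≤ κ * (y + v) := by nlinarith

lemma norm_surrogatePair_const_sub_le (h : IsStableLoop κ ρ b A B K)
    (hw : ∀ s < t, ‖w s‖ ≤ ω) (M N : Param H d₁ d₂) :
    ‖surrogatePair A B K w (fun _ => M) t - surrogatePair A B K w (fun _ => N) t‖ ≤
      2 * policySensitivity κ ρ b ω * √(H : ℝ) * ‖M - N‖ := by
  have hκ := h.kappa_nonneg
  have hb := h.bound_nonneg
  have hω : 0 ≤ ω := (norm_nonneg _).trans (hw (t - 1) (by omega))
  set φ := √(H : ℝ) * ‖M - N‖ * ω with φ_def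
  have hφ : 0 ≤ φ := by positivity
  have feedback_le (s : ℤ) (hs : s ≤ t) : ‖feedback w s (M - N)‖ ≤ φ :=
    norm_feedback_le (fun r hr => hw r (by omega)) _
  calc _ ≤ 2 * κ * ‖surrogateState A B K w (fun _ => M) t -
            surrogateState A B K w (fun _ => N) t‖ + ‖feedback w t M - feedback w t N‖ :=
        norm_surrogatePair_sub_le h.one_le h.norm_gain_le _ _
    _ ≤ 2 * κ * (κ ^ 2 * b * φ * ∑ n ∈ Finset.range (H + 1), ρ ^ n) + φ := by
        rw [← map_sub]
        gcongr
        · exact h.norm_surrogateState_sub_le_sum fun s _ hs => feedback_le s hs.le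
        · exact feedback_le t le_rfl
    _ ≤ 2 * κ * (κ ^ 2 * b * φ * (1 / (1 - ρ))) + 2 * φ := by
        gcongr
        · exact sum_range_pow_le h.rate_nonneg h.rate_lt_one _
        · linarith
    _ = _ := by rw [φ_def, policySensitivity]; ring

/-- The feedbacks which enter the surrogate state use policies of age at most `H + 1`, and there are
`H + 1` of them. -/
lemma norm_surrogatePair_sub_const_le (h : IsStableLoop κ ρ b A B K) (hH : 1 ≤ H)
    (hw : ∀ s < t, ‖w s‖ ≤ ω) {M : ℤ → Param H d₁ d₂} {a : ℤ} (hδ : 0 ≤ δ)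
    (hwa : ∀ s < a, w s = 0) (hdrift : ∀ n : ℕ, a ≤ t - n → ‖M (t - n) - M t‖ ≤ n * δ) :
    ‖surrogatePair A B K w M t - surrogatePair A B K w (fun _ => M t) t‖ ≤
      8 * κ ^ 3 * b * ω * √(H : ℝ) * H ^ 2 * δ := by
  have hκ := h.kappa_nonneg
  have hb := h.bound_nonneg
  have hω : 0 ≤ ω := (norm_nonneg _).trans (hw (t - 1) (by omega))
  have hH1 : (1 : ℝ) ≤ H := Nat.one_le_cast.2 hH
  have feedback_le (s : ℤ) (hs : t - (H + 1) ≤ s) (hst : s < t) :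
      ‖feedback w s (M s - M t)‖ ≤ √(H : ℝ) * ((H + 1) * δ) * ω := by
    rcases lt_or_ge s a with before | after
    · rw [feedback_eq_zero fun r hr => hwa r (by omega), norm_zero]
      positivity
    · obtain ⟨n, rfl⟩ : ∃ n : ℕ, s = t - n := ⟨(t - s).toNat, by omega⟩
      have recent : (n : ℝ) ≤ H + 1 := by exact_mod_cast (by omega : n ≤ H + 1)
      refine (norm_feedback_le (fun r hr => hw r (by omega)) _).trans ?_
      gcongr
      exact (hdrift n after).trans (by gcongr)
  have pow_sum_le : ∑ n ∈ Finset.range (H + 1), ρ ^ n ≤ H + 1 := by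
    calc _ ≤ ∑ _n ∈ Finset.range (H + 1), (1 : ℝ) :=
          Finset.sum_le_sum fun n _ => pow_le_one₀ h.rate_nonneg h.rate_lt_one.le
      _ = H + 1 := by simp
  calc _ ≤ 2 * κ * ‖surrogateState A B K w M t - surrogateState A B K w (fun _ => M t) t‖ +
          ‖feedback w t (M t) - feedback w t (M t)‖ :=
        norm_surrogatePair_sub_le h.one_le h.norm_gain_le _ _
    _ ≤ 2 * κ * (κ ^ 2 * b * (√(H : ℝ) * ((H + 1) * δ) * ω) * (H + 1)) := by
        rw [sub_self, norm_zero, add_zero]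
        gcongr
        exact (h.norm_surrogateState_sub_le_sum feedback_le).trans (by gcongr)
    _ = 2 * κ ^ 3 * b * ω * √(H : ℝ) * (H + 1) ^ 2 * δ := by ring
    _ ≤ 2 * κ ^ 3 * b * ω * √(H : ℝ) * (2 * H) ^ 2 * δ := by gcongr; linarith
    _ = _ := by ring

lemma norm_surrogatePair_sub_le_systemSensitivity (h : IsStableLoop κ ρ b A B K)
    (h' : IsStableLoop κ ρ b A' B' K) (hγ : 0 < γ) (hγ1 : γ ≤ 1) (hA : ‖A - A'‖ ≤ δ)
    (hB : ‖B - B'‖ ≤ δ) (hw : ∀ s < t, ‖w s‖ ≤ ω) (hww' : ∀ s < t, ‖w s - w' s‖ ≤ δw)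
    {M : Param H d₁ d₂} (hM : M ∈ policySet H d₁ d₂ κ γ) :
    ‖surrogatePair A B K w (fun _ => M) t - surrogatePair A' B' K w' (fun _ => M) t‖ ≤
      2 * systemSensitivity H κ γ ρ b ω δ δw := by
  have hκ := h.kappa_nonneg
  calc _ ≤ 2 * κ * ‖surrogateState A B K w (fun _ => M) t -
            surrogateState A' B' K w' (fun _ => M) t‖ + ‖feedback w t M - feedback w' t M‖ :=
        norm_surrogatePair_sub_le h.one_le h.norm_gain_le _ _
    _ ≤ 2 * κ * stateDeviation H κ ρ b ω δ δw + 2 * κ ^ 3 * δw / γ := by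
        rw [← feedback_sub_disturbance]
        gcongr
        · exact h.norm_surrogateState_sub_le_stateDeviation h' hγ hγ1 hA hB hw hww' hM
        · exact norm_feedback_le_of_mem_policySet hκ hγ hγ1 hww' hM
    _ = _ := by rw [systemSensitivity]; ring

end IsStableLoop

end SurrogatePair

section SurrogateCost

variable {H d₁ d₂ : ℕ} {A A' : Matrix (Fin d₁) (Fin d₁) ℝ} {B B' : Matrix (Fin d₁) (Fin d₂) ℝ}
  {K : Matrix (Fin d₂) (Fin d₁) ℝ} {w w' : ℤ → Vec d₁} {t : ℤ}
  {κ γ ρ b ω δ Gc : ℝ} {c : StateAction d₁ d₂ → ℝ}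

/-- The bound for the gradients of the surrogate costs. -/
noncomputable def gradientBound (H : ℕ) (κ γ ρ b ω Gc : ℝ) : ℝ :=
  Gc * surrogateRadius H κ γ ρ b ω * (2 * policySensitivity κ ρ b ω * √(H : ℝ))

namespace IsStableLoop

lemma gradientBound_nonneg (h : IsStableLoop κ ρ b A B K) (hγ : 0 < γ) (hω : 0 ≤ ω)
    (hGc : 0 ≤ Gc) : 0 ≤ gradientBound H κ γ ρ b ω Gc := by
  have := h.policySensitivity_nonneg hω
  have := h.surrogateRadius_nonneg (H := H) hγ hω
  unfold gradientBound
  positivity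

lemma surrogateCost_sub_le (h : IsStableLoop κ ρ b A B K) (h' : IsStableLoop κ ρ b A' B' K)
    (hc : CostAssumption Gc c) (hγ : 0 < γ) (hγ1 : γ ≤ 1) (hw : ∀ s < t, ‖w s‖ ≤ ω)
    (hw' : ∀ s < t, ‖w' s‖ ≤ ω) {M N : ℤ → Param H d₁ d₂}
    (hM : ∀ s ≤ t, (∀ r < s, w r = 0) ∨ M s ∈ policySet H d₁ d₂ κ γ)
    (hN : ∀ s ≤ t, N s ∈ policySet H d₁ d₂ κ γ)
    (hMN : ‖surrogatePair A B K w M t - surrogatePair A' B' K w' N t‖ ≤ δ) :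
    surrogateCost c A B K w t M - surrogateCost c A' B' K w' t N ≤
      Gc * surrogateRadius H κ γ ρ b ω * δ := by
  obtain ⟨state_le, action_le⟩ := h.norm_surrogatePair_le hγ hγ1 hw hM
  obtain ⟨state_le', action_le'⟩ := h'.norm_surrogatePair_le hγ hγ1 hw' fun s hs => .inr (hN s hs)
  have cost_slope_nonneg : 0 ≤ Gc * surrogateRadius H κ γ ρ b ω :=
    (norm_nonneg _).trans (hc.2.2 _ (surrogatePair A B K w M t) state_le action_le)
  exact (hc.sub_le (z := surrogatePair A B K w M t) (z' := surrogatePair A' B' K w' N t)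
    state_le action_le state_le' action_le').trans (by gcongr)

lemma norm_gradient_surrogateCost_le (h : IsStableLoop κ ρ b A B K) (hc : CostAssumption Gc c)
    (hγ : 0 < γ) (hγ1 : γ ≤ 1) (hw : ∀ s < t, ‖w s‖ ≤ ω) {M : Param H d₁ d₂}
    (hM : M ∈ policySet H d₁ d₂ κ γ) :
    ‖gradient (fun M : Param H d₁ d₂ => surrogateCost c A B K w t fun _ => M) M‖ ≤
      gradientBound H κ γ ρ b ω Gc := by
  have hω : 0 ≤ ω := (norm_nonneg _).trans (hw (t - 1) (by omega))
  have hS := h.policySensitivity_nonneg hω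
  have lipschitz (v : Param H d₁ d₂) : ‖constPolicyPair A B K w t v‖ ≤
      2 * policySensitivity κ ρ b ω * √(H : ℝ) * ‖v‖ := by
    have := h.norm_surrogatePair_const_sub_le hw v 0
    rwa [surrogatePair_const A B K w v, add_sub_cancel_left, sub_zero] at this
  obtain ⟨state_le, action_le⟩ :=
    h.norm_surrogatePair_le hγ hγ1 hw (M := fun _ => M) fun _ _ => .inr hM
  have cost_gradient_le : ‖gradient c (surrogatePair A B K w (fun _ => M) t)‖ ≤
      Gc * surrogateRadius H κ γ ρ b ω := hc.2.2 _ _ state_le action_le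
  have chain_rule := norm_gradient_comp_affine_le (c := c) (x := M)
    (p := surrogatePair A B K w (fun _ => (0 : Param H d₁ d₂)) t) (hc.2.1 _) (by positivity)
    lipschitz
  simp only [← surrogatePair_const] at chain_rule
  exact chain_rule.trans (by rw [gradientBound]; gcongr)

end IsStableLoop

end SurrogateCost

section ClosedLoop

variable {d₁ d₂ : ℕ} {A : Matrix (Fin d₁) (Fin d₁) ℝ} {B : Matrix (Fin d₁) (Fin d₂) ℝ}
  {K : Matrix (Fin d₂) (Fin d₁) ℝ} {x w : ℤ → Vec d₁} {u : ℤ → Vec d₂} {κ γ V W : ℝ} {N : ℤ}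

lemma StronglyStable.norm_state_control_le (hK : StronglyStable κ γ A B K) (hB : ‖B‖ ≤ κ)
    (hW : 0 ≤ W) (hV : 0 ≤ V) (hx₁ : x 1 = 0)
    (hx : ∀ t, 1 ≤ t → t < N → x (t + 1) = act A (x t) + act B (u t) + w t)
    (hw : ∀ t, ‖w t‖ ≤ W) (hu : ∀ t, 1 ≤ t → t ≤ N → ‖u t + act K (x t)‖ ≤ V) (hN : 1 ≤ N) :
    ‖x N‖ ≤ κ ^ 2 * (κ * V + W) / γ ∧
      ‖u N‖ ≤ κ * (κ ^ 2 * (κ * V + W) / γ) + V := by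
  have ⟨hκ, hγ, _, hKκ, _⟩ := hK
  have state_le : ‖x N‖ ≤ κ ^ 2 * (κ * V + W) / γ := by
    refine hK.isSimilarToContraction.norm_state_le hγ
      (r := fun t => act B (u t + act K (x t)) + w t) (by positivity) hx₁ (fun t ht htN => ?_)
      (fun t ht htN => norm_add_le_of_le (norm_act_le_of_le hB (hu t ht htN.le)) (hw t)) hN le_rfl
    rw [hx t ht htN, sub_act, act_add, act_act]
    abel
  refine ⟨state_le, ?_⟩
  calc ‖u N‖ = ‖(u N + act K (x N)) - act K (x N)‖ := by rw [add_sub_cancel_right]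
    _ ≤ V + κ * (κ ^ 2 * (κ * V + W) / γ) :=
        norm_sub_le_of_le (hu N hN le_rfl) (norm_act_le_of_le hKκ state_le)
    _ = _ := add_comm _ _

end ClosedLoop

section Constants

variable {d₂ : ℕ} {κ γ W ε : ℝ}

lemma zeta_nonneg (hκ : 1 ≤ κ) (hW : 1 ≤ W) : 0 ≤ zeta κ γ W d₂ := by
  unfold zeta
  positivity

lemma noiseBound_nonneg (hκ : 1 ≤ κ) (hW : 1 ≤ W) (hε : 0 ≤ ε) : 0 ≤ noiseBound κ γ W ε d₂ :=
  add_nonneg (by linarith) (mul_nonneg (zeta_nonneg hκ hW) hε)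

lemma one_le_sqrt_natCast (hd₂ : 0 < d₂) : 1 ≤ √(d₂ : ℝ) :=
  Real.one_le_sqrt.2 (Nat.one_le_cast.2 hd₂)

lemma noiseBound_le (hd₂ : 0 < d₂) (hκ : 1 ≤ κ) (hγ : 0 < γ) (hW : 1 ≤ W)
    (hε : ε ≤ γ ^ 2 / (12 * κ ^ 7)) : noiseBound κ γ W ε d₂ ≤ 3 * W * √(d₂ : ℝ) := by
  have hd₂' := one_le_sqrt_natCast hd₂
  calc noiseBound κ γ W ε d₂ = W * 1 + zeta κ γ W d₂ * ε := by rw [noiseBound, mul_one]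
    _ ≤ W * √(d₂ : ℝ) + zeta κ γ W d₂ * (γ ^ 2 / (12 * κ ^ 7)) := by
        have := zeta_nonneg (d₂ := d₂) (γ := γ) hκ hW
        gcongr
    _ = 3 * W * √(d₂ : ℝ) := by unfold zeta; field_simp; norm_num

/-- A bound for `u + K x`: the random excitations have norm `√d₂`, and the disturbance feedback
of a feasible policy is at most `2κ³/γ` times the size `3 W √d₂` of the disturbance estimates. -/
noncomputable def excitationBound (κ γ W : ℝ) (d₂ : ℕ) : ℝ :=
  2 * κ ^ 3 * (3 * W * √(d₂ : ℝ)) / γ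

lemma sqrt_le_excitationBound (hκ : 1 ≤ κ) (hγ : 0 < γ) (hγ1 : γ ≤ 1) (hW : 1 ≤ W) :
    √(d₂ : ℝ) ≤ excitationBound κ γ W d₂ := by
  have : 1 ≤ κ ^ 3 := one_le_pow₀ hκ
  rw [excitationBound, le_div_iff₀ hγ]
  calc √(d₂ : ℝ) * γ ≤ √(d₂ : ℝ) * 1 := by gcongr
    _ = 1 * 1 * (1 * 1 * √(d₂ : ℝ)) := by ring
    _ ≤ 2 * κ ^ 3 * (3 * W * √(d₂ : ℝ)) := by gcongr <;> norm_num

/-- The left side is the gain from the estimation error of the matrices to that of the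
disturbances. -/
lemma gain_le_zeta (hd₂ : 0 < d₂) (hκ : 1 ≤ κ) (hγ : 0 < γ) (hγ1 : γ ≤ 1) (hW : 1 ≤ W) :
    (1 + κ) * (κ ^ 2 * (κ * excitationBound κ γ W d₂ + W) / γ) + excitationBound κ γ W d₂ ≤
      zeta κ γ W d₂ := by
  have hs := one_le_sqrt_natCast hd₂
  set s := √(d₂ : ℝ)
  have noise_le : W ≤ κ ^ 4 * W * s / γ := by
    have : 1 ≤ κ ^ 4 := one_le_pow₀ hκ
    rw [le_div_iff₀ hγ]
    calc W * γ ≤ W * 1 := by gcongr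
      _ = 1 * W * 1 := by ring
      _ ≤ κ ^ 4 * W * s := by gcongr
  have excitation_le : excitationBound κ γ W d₂ ≤ 6 * κ ^ 7 * W * s / γ ^ 2 := by
    have : κ ^ 3 ≤ κ ^ 7 := pow_le_pow_right₀ hκ (by norm_num)
    have : γ ^ 2 ≤ γ := by nlinarith
    calc excitationBound κ γ W d₂ = 6 * κ ^ 3 * W * s / γ := by rw [excitationBound]; ring
      _ ≤ _ := by gcongr
  calc _ ≤ (κ + κ) * (κ ^ 2 * (κ * excitationBound κ γ W d₂ + κ ^ 4 * W * s / γ) / γ) +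
          6 * κ ^ 7 * W * s / γ ^ 2 := by
        have : 0 ≤ excitationBound κ γ W d₂ := by unfold excitationBound; positivity
        gcongr
    _ = 20 * W * s * κ ^ 7 / γ ^ 2 := by rw [excitationBound]; field_simp; ring
    _ ≤ zeta κ γ W d₂ := by rw [zeta]; gcongr; norm_num

end Constants

section Disturbance

lemma norm_eq_sqrt_of_forall_eq_one_or_neg_one {d : ℕ} {x : Vec d}
    (hx : ∀ a, x a = 1 ∨ x a = -1) : ‖x‖ = √(d : ℝ) := by
  have sq_eq (a : Fin d) : ‖x a‖ ^ 2 = 1 := by rcases hx a with h | h <;> simp [h]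
  simp only [EuclideanSpace.norm_eq, sq_eq, Finset.sum_const, Finset.card_univ, Fintype.card_fin,
    nsmul_eq_mul, mul_one]

namespace Trajectory.IsRun

variable {m H d₁ d₂ : ℕ} {τ : Trajectory m H d₁ d₂} {A : Matrix (Fin d₁) (Fin d₁) ℝ}
  {B : Matrix (Fin d₁) (Fin d₂) ℝ} {K : Matrix (Fin d₂) (Fin d₁) ℝ} {w : ℤ → Vec d₁}
  {P : Matrix (Fin m) (Fin m) ℝ} {c : Fin m → ℤ → StateAction d₁ d₂ → ℝ}
  {κ γ η W ε : ℝ} {q Tc Te T : ℕ} {i : Fin m} {N : ℤ}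

lemma mem_policySet (h : τ.IsRun A B K w P c κ γ η q Tc Te T) (i : Fin m) {t : ℤ}
    (ht : (Tc : ℤ) + Te < t) (htT : t ≤ T + 1) : τ.M i t ∈ policySet H d₁ d₂ κ γ := by
  rcases eq_or_lt_of_le (Int.add_one_le_iff.2 ht) with rfl | after_first
  · obtain ⟨M₀, hM₀, init⟩ := h.init_policy
    exact init i ▸ hM₀
  · have := (h.update i (t - 1) (by omega) (by omega)).1
    rwa [sub_add_cancel] at this

lemma what_sub_eq (h : τ.IsRun A B K w P c κ γ η q Tc Te T) (i : Fin m) {t : ℤ}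
    (ht : (Tc : ℤ) + Te < t) (htT : t ≤ T) :
    τ.what i t - w t = act (A - τ.hatA P K q Tc Te i) (τ.x i t) +
      act (B - τ.hatB P q Tc Te i) (τ.u i t) := by
  rw [h.what_learn i t ht htT, h.dynamics i t (by omega), sub_act, sub_act]
  abel

lemma norm_excitation_le (h : τ.IsRun A B K w P c κ γ η q Tc Te T) (hκ : 1 ≤ κ) (hγ : 0 < γ)
    (hγ1 : γ ≤ 1) (hW : 1 ≤ W) (hNT : N ≤ T)
    (hwhat : ∀ r < N, ‖τ.what i r‖ ≤ 3 * W * √(d₂ : ℝ)) {t : ℤ} (ht : 1 ≤ t) (htN : t ≤ N) :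
    ‖τ.u i t + act K (τ.x i t)‖ ≤ excitationBound κ γ W d₂ := by
  rcases le_or_gt t ((Tc : ℤ) + Te) with explore | learn
  · rw [h.explore i t ht explore, neg_add_cancel_comm,
      norm_eq_sqrt_of_forall_eq_one_or_neg_one (h.excitation i t)]
    exact sqrt_le_excitationBound hκ hγ hγ1 hW
  · rw [h.control i t learn (by omega), neg_add_cancel_comm, ← feedback_apply]
    exact norm_feedback_le_of_mem_policySet (by linarith) hγ hγ1 (fun r hr => hwhat r (by omega))
      (h.mem_policySet i learn (by omega))

lemma norm_what_sub_le_of_forall_lt (h : τ.IsRun A B K w P c κ γ η q Tc Te T) (hd₂ : 0 < d₂)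
    (hκ : 1 ≤ κ) (hW : 1 ≤ W) (hB : ‖B‖ ≤ κ) (hw : ∀ t, ‖w t‖ ≤ W)
    (hK : StronglyStable κ γ A B K) (hAε : ‖A - τ.hatA P K q Tc Te i‖ ≤ ε)
    (hBε : ‖B - τ.hatB P q Tc Te i‖ ≤ ε) (hN : (Tc : ℤ) + Te < N) (hNT : N ≤ T)
    (hwhat : ∀ r < N, ‖τ.what i r‖ ≤ 3 * W * √(d₂ : ℝ)) :
    ‖τ.what i N - w N‖ ≤ zeta κ γ W d₂ * ε := by
  have ⟨_, hγ, hγ1, _⟩ := hK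
  have hε : 0 ≤ ε := (norm_nonneg _).trans hAε
  set V := excitationBound κ γ W d₂
  have hV : 0 ≤ V := (Real.sqrt_nonneg _).trans (sqrt_le_excitationBound hκ hγ hγ1 hW)
  obtain ⟨state_le, control_le⟩ := hK.norm_state_control_le hB (by linarith) hV (h.init_state i)
    (fun t ht _ => h.dynamics i t ht) hw
    (fun t ht htN => h.norm_excitation_le hκ hγ hγ1 hW hNT hwhat ht htN) (N := N) (by omega)
  rw [h.what_sub_eq i hN hNT]
  set X := κ ^ 2 * (κ * V + W) / γ
  calc _ ≤ ε * X + ε * (κ * X + V) :=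
        norm_add_le_of_le (norm_act_le_of_le hAε state_le) (norm_act_le_of_le hBε control_le)
    _ = ((1 + κ) * X + V) * ε := by ring
    _ ≤ zeta κ γ W d₂ * ε := by gcongr; exact gain_le_zeta hd₂ hκ hγ hγ1 hW

lemma norm_what_le (h : τ.IsRun A B K w P c κ γ η q Tc Te T) (hd₂ : 0 < d₂)
    (hκ : 1 ≤ κ) (hW : 1 ≤ W) (hB : ‖B‖ ≤ κ) (hw : ∀ t, ‖w t‖ ≤ W)
    (hK : StronglyStable κ γ A B K) (hεγ : ε ≤ γ ^ 2 / (12 * κ ^ 7))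
    (hAε : ‖A - τ.hatA P K q Tc Te i‖ ≤ ε) (hBε : ‖B - τ.hatB P q Tc Te i‖ ≤ ε) {t : ℤ}
    (ht : t ≤ T) : ‖τ.what i t‖ ≤ noiseBound κ γ W ε d₂ := by
  have bound_le : noiseBound κ γ W ε d₂ ≤ 3 * W * √(d₂ : ℝ) :=
    noiseBound_le hd₂ hκ hK.2.1 hW hεγ
  have bound_nonneg : 0 ≤ noiseBound κ γ W ε d₂ :=
    noiseBound_nonneg hκ hW ((norm_nonneg _).trans hAε)
  have explore (r : ℤ) (hr : r ≤ (Tc : ℤ) + Te) : ‖τ.what i r‖ ≤ noiseBound κ γ W ε d₂ := by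
    rwa [h.what_explore i r hr, norm_zero]
  have all_up_to (N : ℤ) (hN : (Tc : ℤ) + Te ≤ N) :
      N ≤ T → ∀ r ≤ N, ‖τ.what i r‖ ≤ noiseBound κ γ W ε d₂ := by
    induction N, hN using Int.leInduction with
    | base => exact fun _ => explore
    | succ N hN ih =>
      intro hNT r hr
      rcases Int.le_add_one_iff.1 hr with earlier | rfl
      · exact ih (by omega) r earlier
      · rw [← add_sub_cancel (w (N + 1)) (τ.what i (N + 1))]
        exact norm_add_le_of_le (hw _) <|
          h.norm_what_sub_le_of_forall_lt hd₂ hκ hW hB hw hK hAε hBε (by omega) hNT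
            fun r hr => (ih (by omega) r (by omega)).trans bound_le
  rcases le_or_gt t ((Tc : ℤ) + Te) with ht₀ | ht₀
  · exact explore t ht₀
  · exact all_up_to t ht₀.le ht t le_rfl

lemma norm_what_sub_le (h : τ.IsRun A B K w P c κ γ η q Tc Te T) (hd₂ : 0 < d₂)
    (hκ : 1 ≤ κ) (hW : 1 ≤ W) (hB : ‖B‖ ≤ κ) (hw : ∀ t, ‖w t‖ ≤ W)
    (hK : StronglyStable κ γ A B K) (hεγ : ε ≤ γ ^ 2 / (12 * κ ^ 7))
    (hAε : ‖A - τ.hatA P K q Tc Te i‖ ≤ ε) (hBε : ‖B - τ.hatB P q Tc Te i‖ ≤ ε) {t : ℤ}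
    (ht₀ : (Tc : ℤ) + Te < t) (ht : t ≤ T) :
    ‖τ.what i t - w t‖ ≤ zeta κ γ W d₂ * ε :=
  h.norm_what_sub_le_of_forall_lt hd₂ hκ hW hB hw hK hAε hBε ht₀ ht fun _ hr =>
    (h.norm_what_le hd₂ hκ hW hB hw hK hεγ hAε hBε (by omega)).trans
      (noiseBound_le hd₂ hκ hK.2.1 hW hεγ)

end Trajectory.IsRun

end Disturbance

section Regret

variable {m H d₁ d₂ : ℕ} {A : Fin m → Matrix (Fin d₁) (Fin d₁) ℝ}
  {B : Fin m → Matrix (Fin d₁) (Fin d₂) ℝ} {K : Matrix (Fin d₂) (Fin d₁) ℝ}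
  {w : Fin m → ℤ → Vec d₁} {κ γ ρ b ω δ δw η r Gc : ℝ} {a N : ℤ}

/-- Every agent works on its own stable system `(A i, B i)` with its own bounded disturbances `w i`;
up to the horizon `N` the systems differ by at most `δ` and the disturbances by at most `δw`, and
there are no disturbances before time `a`. -/
structure IsEstimateFamily (κ ρ b ω δ δw : ℝ) (A : Fin m → Matrix (Fin d₁) (Fin d₁) ℝ)
    (B : Fin m → Matrix (Fin d₁) (Fin d₂) ℝ) (K : Matrix (Fin d₂) (Fin d₁) ℝ)
    (w : Fin m → ℤ → Vec d₁) (a N : ℤ) : Prop where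
  isStableLoop : ∀ i, IsStableLoop κ ρ b (A i) (B i) K
  norm_state_sub_le : ∀ i l, ‖A i - A l‖ ≤ δ
  norm_input_sub_le : ∀ i l, ‖B i - B l‖ ≤ δ
  norm_disturbance_le : ∀ i, ∀ t ≤ N, ‖w i t‖ ≤ ω
  norm_disturbance_sub_le : ∀ i l, ∀ t ≤ N, ‖w i t - w l t‖ ≤ δw
  disturbance_eq_zero : ∀ i, ∀ t < a, w i t = 0

/-- Agent `i`'s gradient of its surrogate cost in the current policy. -/
noncomputable def policyGradient (c : Fin m → ℤ → StateAction d₁ d₂ → ℝ)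
    (A : Fin m → Matrix (Fin d₁) (Fin d₁) ℝ) (B : Fin m → Matrix (Fin d₁) (Fin d₂) ℝ)
    (K : Matrix (Fin d₂) (Fin d₁) ℝ) (w : Fin m → ℤ → Vec d₁) (M : Fin m → ℤ → Param H d₁ d₂)
    (i : Fin m) (t : ℤ) : Param H d₁ d₂ :=
  gradient (fun M : Param H d₁ d₂ => surrogateCost (c i t) (A i) (B i) K (w i) t fun _ => M)
    (M i t)

/-- The distance between one agent's surrogate state and action along its own policies, and those
of another agent under its current policy, when the policies stay within consensus radius `R`:
the contributions of the memory, of the different systems, and of the different policies. -/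
noncomputable def surrogateGap (H : ℕ) (κ γ ρ b ω δ δw R : ℝ) : ℝ :=
  8 * κ ^ 3 * b * ω * √(H : ℝ) * H ^ 2 * (3 * R) + 2 * systemSensitivity H κ γ ρ b ω δ δw +
    2 * policySensitivity κ ρ b ω * √(H : ℝ) * (2 * R)

/-- A bound for the contribution of one agent and one round to the regret. -/
noncomputable def regretRate (H : ℕ) (κ γ ρ b ω δ δw Gc η : ℝ) (P : Matrix (Fin m) (Fin m) ℝ) : ℝ :=
  let G := gradientBound H κ γ ρ b ω Gc
  let R := consensusRadius P (η * G)
  η * G ^ 2 / 2 + G * (2 * R) +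
    Gc * surrogateRadius H κ γ ρ b ω * surrogateGap H κ γ ρ b ω δ δw R

namespace IsEstimateFamily

variable {P : Matrix (Fin m) (Fin m) ℝ} {c : Fin m → ℤ → StateAction d₁ d₂ → ℝ}
  {M : Fin m → ℤ → Param H d₁ d₂} {t : ℤ}

lemma regretRate_nonneg (h : IsEstimateFamily κ ρ b ω δ δw A B K w a N) (hP : IsNetworkMatrix P)
    (hγ : 0 < γ) (hη : 0 ≤ η) (hGc : 0 ≤ Gc) (j : Fin m) :
    0 ≤ regretRate H κ γ ρ b ω δ δw Gc η P := by
  have stable := h.isStableLoop j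
  have hω : 0 ≤ ω := (norm_nonneg _).trans (h.norm_disturbance_le j N le_rfl)
  have := stable.kappa_nonneg
  have := stable.bound_nonneg
  have := stable.one_sub_pos
  have := stable.policySensitivity_nonneg hω
  have := stable.surrogateRadius_nonneg (H := H) hγ hω
  have hG := stable.gradientBound_nonneg (H := H) hγ hω hGc
  have := hP.consensusRadius_nonneg (mul_nonneg hη hG)
  have hδ : 0 ≤ δ := (norm_nonneg _).trans (h.norm_state_sub_le j j)
  have hδw : 0 ≤ δw := (norm_nonneg _).trans (h.norm_disturbance_sub_le j j N le_rfl)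
  unfold regretRate surrogateGap systemSensitivity stateDeviation
  positivity

lemma norm_surrogatePair_sub_le_surrogateGap
    (h : IsEstimateFamily κ ρ b ω δ δw A B K w a N) (hP : IsNetworkMatrix P)
    (hM : IsPerturbedAveraging P r M a N) (hr : 0 ≤ r) (hγ : 0 < γ) (hγ1 : γ ≤ 1) (hH : 1 ≤ H)
    (hat : a ≤ t) (htN : t ≤ N) (i j : Fin m) (hMj : M j t ∈ policySet H d₁ d₂ κ γ) :
    ‖surrogatePair (A j) (B j) K (w j) (M j) t -
        surrogatePair (A i) (B i) K (w i) (fun _ => M i t) t‖ ≤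
      surrogateGap H κ γ ρ b ω δ δw (consensusRadius P r) := by
  have hR := hP.consensusRadius_nonneg hr
  have bounded (l : Fin m) (s : ℤ) (hs : s < t) : ‖w l s‖ ≤ ω :=
    h.norm_disturbance_le l s (by omega)
  have hS := (h.isStableLoop i).policySensitivity_nonneg
    ((norm_nonneg _).trans (bounded i (t - 1) (by omega)))
  have memory := (h.isStableLoop j).norm_surrogatePair_sub_const_le hH (bounded j)
    (by positivity) (h.disturbance_eq_zero j) fun n hn => hM.norm_sub_prev_le hP hr (by omega) j hn
  have system := (h.isStableLoop j).norm_surrogatePair_sub_le_systemSensitivity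
    (h.isStableLoop i) hγ hγ1 (h.norm_state_sub_le j i) (h.norm_input_sub_le j i) (bounded j)
    (fun s hs => h.norm_disturbance_sub_le j i s (by omega)) hMj
  have disagreement := ((h.isStableLoop i).norm_surrogatePair_const_sub_le (bounded i)
    (M j t) (M i t)).trans
      (mul_le_mul_of_nonneg_left (hM.norm_sub_le hP hr hat (by omega) j i) (by positivity))
  exact (norm_sub_le_norm_sub_add_norm_sub _ _ _).trans
    (add_le_add ((norm_sub_le_norm_sub_add_norm_sub _ _ _).trans (add_le_add memory system))
      disagreement)

lemma surrogateCost_sub_le_inner_add (h : IsEstimateFamily κ ρ b ω δ δw A B K w a N)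
    (hc : ∀ i t, CostAssumption Gc (c i t)) (hP : IsNetworkMatrix P)
    (hM : IsPerturbedAveraging P r M a N) (hr : 0 ≤ r) (hγ : 0 < γ) (hγ1 : γ ≤ 1) (hH : 1 ≤ H)
    (hmem : ∀ i s, a ≤ s → s ≤ N → M i s ∈ policySet H d₁ d₂ κ γ)
    (hat : a ≤ t) (htN : t ≤ N) (i j : Fin m) (x : Param H d₁ d₂) :
    surrogateCost (c i t) (A j) (B j) K (w j) t (M j) -
        surrogateCost (c i t) (A i) (B i) K (w i) t (fun _ => x) ≤
      inner ℝ (policyGradient c A B K w M i t) (M i t - x) +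
        Gc * surrogateRadius H κ γ ρ b ω *
          surrogateGap H κ γ ρ b ω δ δw (consensusRadius P r) := by
  have bounded (l : Fin m) (s : ℤ) (hs : s < t) : ‖w l s‖ ≤ ω :=
    h.norm_disturbance_le l s (by omega)
  have feasible (s : ℤ) (hs : s ≤ t) :
      (∀ r < s, w j r = 0) ∨ M j s ∈ policySet H d₁ d₂ κ γ := by
    rcases lt_or_ge s a with before | after
    · exact .inl fun r hr => h.disturbance_eq_zero j r (by omega)
    · exact .inr (hmem j s after (by omega))
  have switch_agent := (h.isStableLoop j).surrogateCost_sub_le (h.isStableLoop i) (hc i t) hγ hγ1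
    (bounded j) (bounded i) feasible (fun _ _ => hmem i t hat htN)
    (h.norm_surrogatePair_sub_le_surrogateGap hP hM hr hγ hγ1 hH hat htN i j (hmem j t hat htN))
  have first_order := surrogateCost_sub_le_inner_gradient (A i) (B i) K (w i) (M i t) t (hc i t) x
  rw [policyGradient]
  linarith

lemma norm_policyGradient_le (h : IsEstimateFamily κ ρ b ω δ δw A B K w a N)
    (hc : ∀ i t, CostAssumption Gc (c i t)) (hγ : 0 < γ) (hγ1 : γ ≤ 1) (htN : t ≤ N) {i : Fin m}
    (hM : M i t ∈ policySet H d₁ d₂ κ γ) :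
    ‖policyGradient c A B K w M i t‖ ≤ gradientBound H κ γ ρ b ω Gc :=
  (h.isStableLoop i).norm_gradient_surrogateCost_le (hc i t) hγ hγ1
    (fun s hs => h.norm_disturbance_le i s (by omega)) hM

theorem sum_surrogateCost_sub_le (h : IsEstimateFamily κ ρ b ω δ δw A B K w a N)
    (hc : ∀ i t, CostAssumption Gc (c i t)) (hP : IsNetworkMatrix P) (hγ : 0 < γ) (hγ1 : γ ≤ 1)
    (hH : 1 ≤ H) (hη : 0 < η)
    (hM : IsProjectedDescent P (policySet H d₁ d₂ κ γ) η (policyGradient c A B K w M) M a N)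
    (j : Fin m) {x : Param H d₁ d₂} (hx : x ∈ policySet H d₁ d₂ κ γ) :
    ∑ t ∈ Finset.Icc a N, ∑ i,
        (surrogateCost (c i t) (A j) (B j) K (w j) t (M j) -
          surrogateCost (c i t) (A i) (B i) K (w i) t (fun _ => x)) ≤
      8 * m * d₁ * κ ^ 6 / γ / η +
        ((Finset.Icc a N).card : ℝ) * (m * regretRate H κ γ ρ b ω δ δw Gc η P) := by
  have mem (i : Fin m) (t : ℤ) (hat : a ≤ t) (htN : t ≤ N) : M i t ∈ policySet H d₁ d₂ κ γ :=
    hM.mem hat (by omega) i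
  have gradient_le (i : Fin m) (t : ℤ) (hat : a ≤ t) (htN : t ≤ N) :=
    h.norm_policyGradient_le hc hγ hγ1 htN (mem i t hat htN)
  have averaging := hM.isPerturbedAveraging hP.2.1 convex_policySet hη.le gradient_le
  have hG := (h.isStableLoop j).gradientBound_nonneg (H := H) hγ
    ((norm_nonneg _).trans (h.norm_disturbance_le j N le_rfl)) (hc j N).nonneg
  set G := gradientBound H κ γ ρ b ω Gc
  have hηG : 0 ≤ η * G := by positivity
  set gap := Gc * surrogateRadius H κ γ ρ b ω *
    surrogateGap H κ γ ρ b ω δ δw (consensusRadius P (η * G))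
  have descent := hM.sum_inner_le hP.2.1 convex_policySet hη gradient_le
    (fun i t hat htN => averaging.norm_mix_sub_le hP hηG hat (by omega) i) hx
  have initial_le : ∑ i, ‖M i a - x‖ ^ 2 ≤ m * (16 * d₁ * κ ^ 6 / γ) := by
    obtain ⟨M₀, hM₀, init⟩ := hM.init
    simp only [init, Finset.sum_const, Finset.card_univ, Fintype.card_fin, nsmul_eq_mul]
    gcongr
    exact norm_sub_sq_le_of_mem_policySet hγ hγ1 hM₀ hx
  calc _ ≤ ∑ t ∈ Finset.Icc a N, ∑ i,
          (inner ℝ (policyGradient c A B K w M i t) (M i t - x) + gap) := by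
        refine Finset.sum_le_sum fun t ht => Finset.sum_le_sum fun i _ => ?_
        obtain ⟨hat, htN⟩ := Finset.mem_Icc.1 ht
        exact h.surrogateCost_sub_le_inner_add hc hP averaging hηG hγ hγ1 hH mem hat htN i j x
    _ = ∑ t ∈ Finset.Icc a N, ∑ i, inner ℝ (policyGradient c A B K w M i t) (M i t - x) +
          ((Finset.Icc a N).card : ℝ) * (m * gap) := by
        simp only [Finset.sum_add_distrib, Finset.sum_const, Finset.card_univ, Fintype.card_fin,
          nsmul_eq_mul]
    _ ≤ m * (16 * d₁ * κ ^ 6 / γ) / (2 * η) + ((Finset.Icc a N).card : ℝ) *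
          (m * (η * G ^ 2 / 2 + G * (2 * consensusRadius P (η * G)))) +
            ((Finset.Icc a N).card : ℝ) * (m * gap) := by
        gcongr
        exact descent.trans (by gcongr)
    _ = _ := by
        rw [regretRate]
        field_simp
        ring

end IsEstimateFamily

end Regret

section Terms

variable {m H T d₂ : ℕ} {P : Matrix (Fin m) (Fin m) ℝ}
  {κ γ ρ ε ε' ω ζ η Gc D d G r S W : ℝ}

lemma memory_contribution_le (hP : IsNetworkMatrix P) (hκ : 0 ≤ κ) (hη : 0 ≤ η) (hε : 0 ≤ ε)
    (hω : 0 ≤ ω) (hGc : 0 ≤ Gc) (hS : 0 ≤ S) (hr : 0 ≤ r) (hrD : r ≤ κ * D) :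
    T * (m * (Gc * r * (8 * κ ^ 3 * (κ + ε) * ω * √(H : ℝ) * H ^ 2 *
        (3 * consensusRadius P (η * (Gc * r * (2 * S * √(H : ℝ)))))))) ≤
      48 * κ ^ 2 * memoryTerm m H T η Gc D κ ε ω S (secondSingularValue P) := by
  have gap_pos : 0 < 1 - secondSingularValue P := by linarith [hP.secondSingularValue_lt_one]
  have hH : √(H : ℝ) ^ 2 = H := Real.sq_sqrt H.cast_nonneg
  set β := secondSingularValue P
  calc _ = 48 * (η * T * m * (√(H : ℝ) ^ 2 * H ^ 2) * (Gc * r) ^ 2 * (κ + ε) * κ ^ 3 * ω *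
          (S * √(m : ℝ) / (1 - β))) := by rw [consensusRadius]; ring
    _ ≤ 48 * (η * T * m * (√(H : ℝ) ^ 2 * H ^ 2) * (Gc * (κ * D)) ^ 2 * (κ + ε) * κ ^ 3 * ω *
          (S * √(m : ℝ) / (1 - β))) := by gcongr
    _ = _ := by rw [hH, memoryTerm]; ring

lemma systemSensitivity_le (hκ : 0 ≤ κ) (hγ : 0 < γ) (hρ : 0 < ρ) (hρ1 : ρ < 1) (hε : 0 ≤ ε)
    (hε' : 0 ≤ ε') (hω : 0 ≤ ω) (hζ : 0 ≤ ζ) :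
    systemSensitivity H κ γ ρ (κ + ε) ω ε' (2 * ζ * ε) ≤
      κ * (2 * κ ^ 5 * ε' * ω / (1 - ρ) ^ 2 +
        4 * κ ^ 8 * H ^ 2 * (κ + ε) * ε' * ω / (ρ * (1 - ρ)) +
        (H + 1) * 2 * κ ^ 5 * ε' * ω / (ρ * (1 - ρ)) +
        (κ ^ 2 + H * (κ + ε) * 2 * κ ^ 5) / (1 - ρ) * (2 * ζ * ε)) + 4 * κ ^ 3 * ζ * ε / γ := by
  have gap_pos : 0 < 1 - ρ := by linarith
  have insert_rate : ρ * (1 - ρ) ≤ 1 - ρ := mul_le_of_le_one_left gap_pos.le hρ1.le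
  calc _ = κ * (2 * κ ^ 5 * ε' * ω / (1 - ρ) ^ 2 +
        4 * κ ^ 8 * H ^ 2 * (κ + ε) * ε' * ω / (1 - ρ) + H * 2 * κ ^ 5 * ε' * ω / (1 - ρ) +
        (κ ^ 2 + H * (κ + ε) * 2 * κ ^ 5) / (1 - ρ) * (2 * ζ * ε)) + 2 * κ ^ 3 * ζ * ε / γ := by
        rw [systemSensitivity, stateDeviation]; ring
    _ ≤ _ := by gcongr <;> linarith

lemma estimation_contribution_le (hκ : 1 ≤ κ) (hγ : 0 < γ) (hρ : 0 < 1 - γ + 2 * κ ^ 3 * ε)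
    (hρ1 : 1 - γ + 2 * κ ^ 3 * ε < 1) (hε : 0 ≤ ε) (hε' : 0 ≤ ε') (hω : 0 ≤ ω) (hζ : 0 ≤ ζ)
    (hGc : 0 ≤ Gc) (hr : 0 ≤ r) (hrD : r ≤ κ * D) :
    T * (m * (Gc * r * (2 * systemSensitivity H κ γ (1 - γ + 2 * κ ^ 3 * ε) (κ + ε) ω ε'
        (2 * ζ * ε)))) ≤
      48 * κ ^ 2 * estimationTerm m H T Gc D κ γ ε ε' ω ζ := by
  have one_le_sqrt : 1 ≤ √(2 : ℝ) := Real.one_le_sqrt.2 (by norm_num)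
  have gap_eq : γ - 2 * κ ^ 3 * ε = 1 - (1 - γ + 2 * κ ^ 3 * ε) := by ring
  have hD : 0 ≤ D := nonneg_of_mul_nonneg_right (hr.trans hrD) (by linarith)
  have hκ0 : 0 ≤ κ := by linarith
  have sensitivity_le := systemSensitivity_le (H := H) hκ0 hγ hρ hρ1 hε hε' hω hζ
  rw [estimationTerm, gap_eq]
  set ρ := 1 - γ + 2 * κ ^ 3 * ε
  have : 0 < 1 - ρ := by linarith
  set X := κ * (_ + _ + _ + _) + 4 * κ ^ 3 * ζ * ε / γ
  have : 0 ≤ X := by positivity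
  calc _ ≤ T * (m * (Gc * r * (2 * X))) := by gcongr
    _ ≤ T * (m * (Gc * (κ * D) * (2 * X))) := by gcongr
    _ = 2 * (κ * 1) * (m * T * Gc * D * 1 * X) := by ring
    _ ≤ 48 * (κ * κ) * (m * T * Gc * D * √2 * X) := by gcongr; norm_num
    _ = _ := by ring

lemma gradient_contribution_le (hη : 0 ≤ η) (hG : 0 ≤ G)
    (hGle : G ≤ 2 * κ * (Gc * D * d * √d * √(H : ℝ) * S)) :
    T * (m * (η * G ^ 2 / 2)) ≤ 2 * κ ^ 2 * gradientTerm m H T η Gc D d S := by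
  calc _ ≤ T * (m * (η * (2 * κ * (Gc * D * d * √d * √(H : ℝ) * S)) ^ 2 / 2)) := by gcongr
    _ = _ := by rw [gradientTerm]; ring

lemma consensus_contribution_le (hP : IsNetworkMatrix P) (hη : 0 < η) (hG : 0 ≤ G)
    (hGle : G ≤ 2 * κ * (Gc * D * d * √d * √(H : ℝ) * S)) :
    T * (m * (4 * (G * consensusRadius P (η * G)))) ≤
      16 * κ ^ 2 * consensusTerm m H T η Gc D d S (secondSingularValue P) := by
  have hηG : 0 ≤ η * G := by positivity
  have hR := hP.consensusRadius_nonneg hηG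
  calc _ = 4 * (1 / η * T * m * (η * G * consensusRadius P (η * G))) := by field_simp
    _ ≤ 4 * (1 / η * T * m * (consensusRadius P (η * G) * consensusRadius P (η * G))) := by
        gcongr; exact hP.le_consensusRadius hηG
    _ = 4 * (1 / η * T * m * consensusRadius P (η * G) ^ 2) := by ring
    _ ≤ 4 * (1 / η * T * m *
          consensusRadius P (η * (2 * κ * (Gc * D * d * √d * √(H : ℝ) * S))) ^ 2) := by
        unfold consensusRadius at hR ⊢
        have gap_pos : 0 < 1 - secondSingularValue P := by linarith [hP.secondSingularValue_lt_one]
        gcongr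
    _ = _ := by rw [consensusTerm, consensusRadius]; ring

lemma regretRate_le (hP : IsNetworkMatrix P) (hκ : 1 ≤ κ) (hγ : 0 < γ) (hη : 0 < η)
    (hρ : 0 < 1 - γ + 2 * κ ^ 3 * ε) (hρ1 : 1 - γ + 2 * κ ^ 3 * ε < 1) (hε : 0 ≤ ε)
    (hε' : 0 ≤ ε') (hω : 0 ≤ ω) (hζ : 0 ≤ ζ) (hGc : 0 ≤ Gc) (hd : 1 ≤ d)
    (hS : policySensitivity κ (1 - γ + 2 * κ ^ 3 * ε) (κ + ε) ω = S)
    (hrD : surrogateRadius H κ γ (1 - γ + 2 * κ ^ 3 * ε) (κ + ε) ω ≤ κ * D) :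
    T * (m * regretRate H κ γ (1 - γ + 2 * κ ^ 3 * ε) (κ + ε) ω ε' (2 * ζ * ε) Gc η P) ≤
      48 * κ ^ 2 * (memoryTerm m H T η Gc D κ ε ω S (secondSingularValue P) +
        estimationTerm m H T Gc D κ γ ε ε' ω ζ + gradientTerm m H T η Gc D d S +
        consensusTerm m H T η Gc D d S (secondSingularValue P)) := by
  have : 0 < 1 - (1 - γ + 2 * κ ^ 3 * ε) := by linarith
  have hr : 0 ≤ surrogateRadius H κ γ (1 - γ + 2 * κ ^ 3 * ε) (κ + ε) ω := by
    unfold surrogateRadius; positivity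
  have hS0 : 0 ≤ S := by rw [← hS, policySensitivity]; positivity
  set r := surrogateRadius H κ γ (1 - γ + 2 * κ ^ 3 * ε) (κ + ε) ω with r_def
  have hD : 0 ≤ D := nonneg_of_mul_nonneg_right (hr.trans hrD) (by linarith)
  set G := Gc * r * (2 * S * √(H : ℝ)) with G_def
  have hG : 0 ≤ G := by positivity
  have G_le : G ≤ 2 * κ * (Gc * D * d * √d * √(H : ℝ) * S) := by
    calc G ≤ Gc * (κ * D) * (2 * S * √(H : ℝ)) := by rw [G_def]; gcongr
      _ = 2 * κ * (Gc * D * 1 * 1 * √(H : ℝ) * S) := by ring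
      _ ≤ 2 * κ * (Gc * D * d * √d * √(H : ℝ) * S) := by
          gcongr
          exact Real.one_le_sqrt.2 hd
  have memory :=
    memory_contribution_le (H := H) (T := T) hP (by linarith) hη.le hε hω hGc hS0 hr hrD
  have estimation :=
    estimation_contribution_le (m := m) (H := H) (T := T) hκ hγ hρ hρ1 hε hε' hω hζ hGc hr hrD
  have gradients := gradient_contribution_le (m := m) (T := T) hη.le hG G_le
  have consensus := consensus_contribution_le (T := T) hP hη hG G_le
  have gradients_nonneg : 0 ≤ κ ^ 2 * gradientTerm m H T η Gc D d S := by
    unfold gradientTerm; positivity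
  have consensus_nonneg :
      0 ≤ κ ^ 2 * consensusTerm m H T η Gc D d S (secondSingularValue P) := by
    unfold consensusTerm; positivity
  simp only [regretRate, surrogateGap, gradientBound, hS, ← r_def, ← G_def]
  rw [← G_def] at memory
  linear_combination memory + estimation + gradients + consensus + 46 * gradients_nonneg +
    32 * consensus_nonneg

lemma disagreementTerm_nonneg (hP : IsNetworkMatrix P) (hη : 0 ≤ η) (hGc : 0 ≤ Gc) (hD : 0 ≤ D)
    (hd : 0 ≤ d) : 0 ≤ disagreementTerm m H T η Gc D d S (secondSingularValue P) := by
  have gap_pos : 0 < 1 - secondSingularValue P := by linarith [hP.secondSingularValue_lt_one]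
  unfold disagreementTerm
  positivity

end Terms

section Assembly

variable {κ γ W ε : ℝ} {d₂ H : ℕ}

lemma perturbation_lt_of_le (hκ : 1 ≤ κ) (hγ : 0 < γ) (hγ1 : γ ≤ 1)
    (hε : ε ≤ γ ^ 2 / (12 * κ ^ 7)) : 2 * κ ^ 3 * ε < γ := by
  have : 1 ≤ κ ^ 4 := one_le_pow₀ hκ
  calc 2 * κ ^ 3 * ε ≤ 2 * κ ^ 3 * (γ ^ 2 / (12 * κ ^ 7)) := by gcongr
    _ = γ * (γ / (6 * κ ^ 4)) := by field_simp; norm_num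
    _ < γ * 1 := by
        gcongr
        rw [div_lt_one (by positivity)]
        linarith
    _ = γ := mul_one γ

lemma surrogateRadius_le_mul_radius (hκ : 0 ≤ κ) (hε : 0 ≤ ε) (hω : 0 ≤ noiseBound κ γ W ε d₂)
    (hρ : 0 ≤ 1 - γ + 2 * κ ^ 3 * ε) (hρ1 : 1 - γ + 2 * κ ^ 3 * ε < 1)
    (hden : κ ^ 2 * (1 - γ + 2 * κ ^ 3 * ε) ^ (H + 1) < 1) :
    surrogateRadius H κ γ (1 - γ + 2 * κ ^ 3 * ε) (κ + ε) (noiseBound κ γ W ε d₂) ≤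
      κ * radius κ γ W ε d₂ H := by
  have gap_eq : γ - 2 * κ ^ 3 * ε = 1 - (1 - γ + 2 * κ ^ 3 * ε) := by ring
  rw [surrogateRadius, radius, gap_eq]
  set ρ := 1 - γ + 2 * κ ^ 3 * ε
  have gap_pos : 0 < 1 - ρ := by linarith
  have : 0 < 1 - κ ^ 2 * ρ ^ (H + 1) := by linarith
  gcongr
  exact mul_le_of_le_one_right gap_pos.le (sub_le_self 1 (by positivity))

lemma radius_nonneg (hκ : 0 ≤ κ) (hγ : 0 < γ) (hε : 0 ≤ ε) (hω : 0 ≤ noiseBound κ γ W ε d₂)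
    (hεγ : 2 * κ ^ 3 * ε < γ) (hden : κ ^ 2 * (1 - γ + 2 * κ ^ 3 * ε) ^ (H + 1) < 1) :
    0 ≤ radius κ γ W ε d₂ H := by
  have : 0 < γ - 2 * κ ^ 3 * ε := by linarith
  have : 0 < 1 - κ ^ 2 * (1 - γ + 2 * κ ^ 3 * ε) ^ (H + 1) := by linarith
  unfold radius
  positivity

lemma policySensitivity_eq_sensitivity :
    policySensitivity κ (1 - γ + 2 * κ ^ 3 * ε) (κ + ε) (noiseBound κ γ W ε d₂) =
      sensitivity κ γ W ε d₂ := by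
  rw [policySensitivity, sensitivity]
  ring_nf

namespace Trajectory.IsRun

variable {m d₁ : ℕ} {τ : Trajectory m H d₁ d₂} {A : Matrix (Fin d₁) (Fin d₁) ℝ}
  {B : Matrix (Fin d₁) (Fin d₂) ℝ} {K : Matrix (Fin d₂) (Fin d₁) ℝ} {w : ℤ → Vec d₁}
  {P : Matrix (Fin m) (Fin m) ℝ} {c : Fin m → ℤ → StateAction d₁ d₂ → ℝ}
  {η ε' : ℝ} {q Tc Te T : ℕ}

lemma isProjectedDescent (h : τ.IsRun A B K w P c κ γ η q Tc Te T) :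
    IsProjectedDescent P (policySet H d₁ d₂ κ γ) η
      (policyGradient c (τ.hatA P K q Tc Te) (τ.hatB P q Tc Te) K τ.what τ.M) τ.M
      ((Tc : ℤ) + Te + 1) T where
  init := h.init_policy
  update i t ht htT := h.update i t (by omega) htT

lemma isEstimateFamily (h : τ.IsRun A B K w P c κ γ η q Tc Te T) (hd₂ : 0 < d₂) (hκ : 1 ≤ κ)
    (hW : 1 ≤ W) (hB : ‖B‖ ≤ κ) (hw : ∀ t, ‖w t‖ ≤ W) (hK : StronglyStable κ γ A B K)
    (hε : 0 ≤ ε) (hεγ : ε ≤ γ ^ 2 / (12 * κ ^ 7))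
    (hest : ∀ i, ‖A - τ.hatA P K q Tc Te i‖ ≤ ε ∧ ‖B - τ.hatB P q Tc Te i‖ ≤ ε)
    (hdiff : ∀ i l, ‖τ.hatA P K q Tc Te i - τ.hatA P K q Tc Te l‖ ≤ ε' ∧
      ‖τ.hatB P q Tc Te i - τ.hatB P q Tc Te l‖ ≤ ε') :
    IsEstimateFamily κ (1 - γ + 2 * κ ^ 3 * ε) (κ + ε) (noiseBound κ γ W ε d₂) ε'
      (2 * zeta κ γ W d₂ * ε) (τ.hatA P K q Tc Te) (τ.hatB P q Tc Te) K τ.what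
      ((Tc : ℤ) + Te + 1) T where
  isStableLoop i :=
    { one_le := hκ
      rate_nonneg := by
        have : 0 ≤ 2 * κ ^ 3 * ε := by positivity
        linarith [hK.2.2.1]
      rate_lt_one := by linarith [perturbation_lt_of_le hκ hK.2.1 hK.2.2.1 hεγ]
      norm_gain_le := hK.2.2.2.1
      norm_input_le := by
        rw [← sub_sub_cancel B (τ.hatB P q Tc Te i)]
        exact norm_sub_le_of_le hB (hest i).2
      norm_pow_le := hK.norm_pow_le hκ (hest i).1 (hest i).2 }
  norm_state_sub_le i l := (hdiff i l).1
  norm_input_sub_le i l := (hdiff i l).2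
  norm_disturbance_le i t ht :=
    h.norm_what_le hd₂ hκ hW hB hw hK hεγ (hest i).1 (hest i).2 ht
  norm_disturbance_sub_le i l t ht := by
    rcases le_or_gt t ((Tc : ℤ) + Te) with explore | learn
    · rw [h.what_explore i t explore, h.what_explore l t explore, sub_zero, norm_zero]
      exact mul_nonneg (mul_nonneg zero_le_two (zeta_nonneg hκ hW)) hε
    · have close (i : Fin m) : ‖τ.what i t - w t‖ ≤ zeta κ γ W d₂ * ε :=
        h.norm_what_sub_le hd₂ hκ hW hB hw hK hεγ (hest i).1 (hest i).2 learn ht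
      rw [← sub_sub_sub_cancel_right _ _ (w t)]
      exact (norm_sub_le_of_le (close i) (close l)).trans_eq (by ring)
  disturbance_eq_zero i t ht := h.what_explore i t (by omega)

lemma memoryRegret_le {ρ b ω δ δw Gc : ℝ} (h : τ.IsRun A B K w P c κ γ η q Tc Te T)
    (hfam : IsEstimateFamily κ ρ b ω δ δw (τ.hatA P K q Tc Te) (τ.hatB P q Tc Te) K τ.what
      ((Tc : ℤ) + Te + 1) T)
    (hc : ∀ i t, CostAssumption Gc (c i t)) (hP : IsNetworkMatrix P) (hγ : 0 < γ) (hγ1 : γ ≤ 1)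
    (hH : 1 ≤ H) (hη : 0 < η) (j : Fin m) {x : Param H d₁ d₂} (hx : x ∈ policySet H d₁ d₂ κ γ) :
    τ.memoryRegret P K q Tc Te T c j x ≤
      8 * m * d₁ * κ ^ 6 / γ / η + T * (m * regretRate H κ γ ρ b ω δ δw Gc η P) := by
  have card_le : ((Finset.Icc ((Tc : ℤ) + Te + 1) (T : ℤ)).card : ℝ) ≤ T := by
    rw [Int.card_Icc]
    exact Nat.cast_le.2 (by omega)
  have rate_nonneg := hfam.regretRate_nonneg (H := H) hP hγ hη.le (hc j 0).nonneg j
  exact (hfam.sum_surrogateCost_sub_le hc hP hγ hγ1 hH hη h.isProjectedDescent j hx).trans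
    (by gcongr)

end Trajectory.IsRun

end Assembly

end DistributedControl

open DistributedControl in
theorem mainTheorem5_general {m d₁ d₂ q H Tc Te T : ℕ} {κ γ W Gc η ε ε' : ℝ}
    {A : Matrix (Fin d₁) (Fin d₁) ℝ} {B : Matrix (Fin d₁) (Fin d₂) ℝ}
    {K : Matrix (Fin d₂) (Fin d₁) ℝ} {w : ℤ → Vec d₁} {P : Matrix (Fin m) (Fin m) ℝ}
    {c : Fin m → ℤ → StateAction d₁ d₂ → ℝ} {τ : Trajectory m H d₁ d₂} (hd₂ : 0 < d₂)
    (hκ : 1 ≤ κ) (hH : 1 ≤ H) (hW : 1 ≤ W) (hη : 0 < η) (hP : IsNetworkMatrix P) (hB : ‖B‖ ≤ κ)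
    (hw : ∀ t, ‖w t‖ ≤ W) (hc : ∀ i t, CostAssumption Gc (c i t)) (hK : StronglyStable κ γ A B K)
    (hrun : τ.IsRun A B K w P c κ γ η q Tc Te T) (hε : 0 < ε) (hεγ : ε ≤ γ ^ 2 / (12 * κ ^ 7))
    (hest : ∀ i, ‖A - τ.hatA P K q Tc Te i‖ ≤ ε ∧ ‖B - τ.hatB P q Tc Te i‖ ≤ ε)
    (hdiff : ∀ i l, ‖τ.hatA P K q Tc Te i - τ.hatA P K q Tc Te l‖ ≤ ε' ∧
      ‖τ.hatB P q Tc Te i - τ.hatB P q Tc Te l‖ ≤ ε')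
    (hden : κ ^ 2 * (1 - γ + 2 * κ ^ 3 * ε) ^ (H + 1) < 1) (j : Fin m) {Mstar : Param H d₁ d₂}
    (hMstar : Mstar ∈ policySet H d₁ d₂ κ γ) :
    let d : ℝ := ((max d₁ d₂ : ℕ) : ℝ)
    let β := secondSingularValue P
    let ζ := zeta κ γ W d₂
    let W' := noiseBound κ γ W ε d₂
    let D := radius κ γ W ε d₂ H
    let S := sensitivity κ γ W ε d₂
    τ.memoryRegret P K q Tc Te T c j Mstar ≤
      8 * m * d₁ * κ ^ 6 / γ / η +
        48 * κ ^ 2 * (memoryTerm m H T η Gc D κ ε W' S β +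
          estimationTerm m H T Gc D κ γ ε ε' W' ζ + gradientTerm m H T η Gc D d S +
          consensusTerm m H T η Gc D d S β) := by
  intro d β ζ W' D S
  have hγ : 0 < γ := hK.2.1
  have hγ1 : γ ≤ 1 := hK.2.2.1
  have hκ0 : 0 < κ := by linarith
  have rate_pos : 0 < 1 - γ + 2 * κ ^ 3 * ε := by
    have : 0 < 2 * κ ^ 3 * ε := by positivity
    linarith
  have rate_lt_one : 1 - γ + 2 * κ ^ 3 * ε < 1 := by
    linarith [perturbation_lt_of_le hκ hγ hγ1 hεγ]
  have noise_nonneg := noiseBound_nonneg (γ := γ) (d₂ := d₂) hκ hW hε.le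
  have one_le_dim : 1 ≤ d := Nat.one_le_cast.2 (le_max_of_le_right hd₂)
  have estimates := hrun.isEstimateFamily hd₂ hκ hW hB hw hK hε.le hεγ hest hdiff
  refine (hrun.memoryRegret_le estimates hc hP hγ hγ1 hH hη j hMstar).trans
    (add_le_add_right ?_ _)
  exact regretRate_le hP hκ hγ hη rate_pos rate_lt_one hε.le ((norm_nonneg _).trans (hdiff j j).1)
    noise_nonneg (zeta_nonneg hκ hW) (hc j 0).nonneg one_le_dim policySensitivity_eq_sensitivity
    (surrogateRadius_le_mul_radius hκ0.le hε.le noise_nonneg rate_pos.le rate_lt_one hden)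

theorem mainTheorem5 :
    -- `C₁` is a universal constant
    ∃ C₁ : ℝ, 0 < C₁ ∧
    ∀ (m d₁ d₂ : ℕ) (κ γ : ℝ), 0 < d₂ → 1 < κ → 0 < γ → γ ≤ 1 →
    -- the constant in the `O(1/η)` term depends on `m`, `d₁`, `d₂`, `κ`, `γ` only
    ∃ C₂ : ℝ, 0 < C₂ ∧
    ∀ (q H Tc Te T : ℕ) (W Gc η ε ε' : ℝ)
      (A : Matrix (Fin d₁) (Fin d₁) ℝ) (B : Matrix (Fin d₁) (Fin d₂) ℝ)
      (K : Matrix (Fin d₂) (Fin d₁) ℝ) (w : ℤ → DistributedControl.Vec d₁)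
      (P : Matrix (Fin m) (Fin m) ℝ)
      (c : Fin m → ℤ → DistributedControl.StateAction d₁ d₂ → ℝ)
      (τ : DistributedControl.Trajectory m H d₁ d₂),
    1 ≤ H → q + 1 < Tc → 1 < W → 1 < Gc → 0 < η →
    -- the network
    DistributedControl.IsNetworkMatrix P →
    -- the system, the disturbances, the costs and the known controller
    ‖A‖ ≤ κ → ‖B‖ ≤ κ → (∀ t, ‖w t‖ ≤ W) →
    (∀ i t, DistributedControl.CostAssumption Gc (c i t)) →
    DistributedControl.StronglyStable κ γ A B K →
    DistributedControl.StronglyControllable q κ (A - B * K) B →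
    -- a run of the algorithm
    τ.IsRun A B K w P c κ γ η q Tc Te T →
    -- `ε` and `ε'` bound the errors of the estimates of this run
    0 < ε → ε ≤ γ ^ 2 / (12 * κ ^ 7) →
    (∀ i, ‖A - τ.hatA P K q Tc Te i‖ ≤ ε ∧ ‖B - τ.hatB P q Tc Te i‖ ≤ ε) →
    (∀ i l, ‖τ.hatA P K q Tc Te i - τ.hatA P K q Tc Te l‖ ≤ ε' ∧
      ‖τ.hatB P q Tc Te i - τ.hatB P q Tc Te l‖ ≤ ε') →
    -- the denominator in `D` is positive
    κ ^ 2 * (1 - γ + 2 * κ ^ 3 * ε) ^ (H + 1) < 1 →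
    ∀ (j : Fin m), ∀ Mstar ∈ DistributedControl.policySet H d₁ d₂ κ γ,
      let d : ℝ := ((max d₁ d₂ : ℕ) : ℝ)
      let β : ℝ := DistributedControl.secondSingularValue P
      let ζ : ℝ := DistributedControl.zeta κ γ W d₂
      let W' : ℝ := DistributedControl.noiseBound κ γ W ε d₂
      let D : ℝ := DistributedControl.radius κ γ W ε d₂ H
      let S : ℝ := DistributedControl.sensitivity κ γ W ε d₂
      τ.memoryRegret P K q Tc Te T c j Mstar ≤
        C₁ * κ ^ 2 * DistributedControl.memoryTerm m H T η Gc D κ ε W' S β +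
        C₁ * κ ^ 2 * DistributedControl.estimationTerm m H T Gc D κ γ ε ε' W' ζ +
        C₁ * κ ^ 2 * DistributedControl.disagreementTerm m H T η Gc D d S β +
        C₁ * κ ^ 2 * DistributedControl.gradientTerm m H T η Gc D d S +
        C₂ * (1 / η) +
        C₁ * κ ^ 2 * DistributedControl.consensusTerm m H T η Gc D d S β := by
  refine ⟨48, by norm_num, fun m d₁ d₂ κ γ hd₂ hκ hγ hγ1 =>
    ⟨8 * m * d₁ * κ ^ 6 / γ + 1, by positivity, ?_⟩⟩
  intro q H Tc Te T W Gc η ε ε' A B K w P c τ hH _ hW _ hη hP _ hB hw hc hK _ hrun hε hεγ hest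
    hdiff hden j Mstar hMstar d β ζ W' D S
  have regret_le := mainTheorem5_general hd₂ hκ.le hH hW.le hη hP hB hw hc hK hrun hε hεγ hest
    hdiff hden j hMstar
  have hD : 0 ≤ D := DistributedControl.radius_nonneg (by linarith) hγ hε.le
    (DistributedControl.noiseBound_nonneg hκ.le hW.le hε.le)
    (DistributedControl.perturbation_lt_of_le hκ.le hγ hγ1 hεγ) hden
  have disagreement_nonneg :=
    DistributedControl.disagreementTerm_nonneg (H := H) (T := T) (S := S) hP hη.le
      (hc j 0).nonneg hD (Nat.cast_nonneg (max d₁ d₂))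
  have inv_nonneg : 0 ≤ 1 / η := by positivity
  linear_combination regret_le + 48 * κ ^ 2 * disagreement_nonneg + inv_nonneg
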